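/- Let $M=D^2\times[0,1]$ be the solid cylinder. Surfaces, curves, balls and isotopies are taken in the tame (locally flat) topological category. For a finite set $B\subset\partial D^2$, a smoothing with boundary $B$ is a compact properly embedded curve $O\subset D^2$ (a disjoint union of circles and arcs) with $O\cap\partial D^2=B$. For smoothings $O,O'$ with boundary $B$, let $\operatorname{Mor}(O,O')$ be the set of compact surfaces $C$ properly embedded in $M$ with $$C\cap\partial M=\partial C=(O\times\{0\})\cup(O'\times\{1\})\cup(B\times[0,1]),$$ up to ambient isotopy of $M$ fixing $\partial M$ pointwise. For a commutative ring $R$, let $R\operatorname{Mor}(O,O')$ be the free $R$-module on this set. **Four tube relation (4Tu).** Suppose a cobordism $C$ meets a ball in the interior of $M$ in four properly embedded, unnested trivial disks $D_1,\dots,D_4$ (the ball with the disks is homeomorphic to the standard picture of four caps placed near the four corners of a square, $D_1,D_2$ above and $D_3,D_4$ below, $D_1,D_3$ on the left and $D_2,D_4$ on the right). Let $C_{ij}$ be obtained from $C$ by removing $D_i$ and $D_j$ and replacing them by a tube inside the ball with the same boundary, unknotted and running along the side $ij$ of the square. The relation is $$C_{12}+C_{34}=C_{13}+C_{24}.$$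 **Neck cutting relation (NC).** Suppose a cobordism $C$ meets a ball in the interior of $M$ in two parallel properly embedded disks. Let $N$ be obtained from $C$ by joining these two disks by a straight tube (a neck) inside the ball, and let $H_1$, respectively $H_2$, be obtained from $C$ by adding an unknotted handle, inside the ball, to the first, respectively the second, disk. The relation is $$2N=H_1+H_2.$$ **Proposition.** If $2$ is invertible in $R$, then the neck cutting relation is equivalent to the 4Tu relation: for every finite $B\subset\partial D^2$ and all smoothings $O,O'$ with boundary $B$, the $R$-submodule of $R\operatorname{Mor}(O,O')$ spanned by all elements $2N-H_1-H_2$ (over all $C$ and all balls as in NC) equals the $R$-submodule spanned by all elements $C_{12}+C_{34}-C_{13}-C_{24}$ (over all $C$ and all balls as in 4Tu). -/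

import Mathlib

/-!
Cobordisms in a solid cylinder between smoothings in the disk, regarded up to isotopy rel
boundary, and two local relations between formal linear combinations of them: the four tube
relation and the neck cutting relation.  "Surface" and "curve" mean locally flat (tame)
topological submanifold.
-/

namespace Bar

/-- Three-space; the coordinates of a point are written `((x, y), t)`. -/
abbrev Space : Type := (ℝ × ℝ) × ℝ

/-- The closed unit disk in the plane. -/
def disk : Set (ℝ × ℝ) := {p | p.1 ^ 2 + p.2 ^ 2 ≤ 1}

/-- The unit circle, the boundary of the disk. -/
def circle : Set (ℝ × ℝ) := {p | p.1 ^ 2 + p.2 ^ 2 = 1}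

/-- The solid cylinder (disk) × [0, 1]. -/
def cylinder : Set Space := disk ×ˢ Set.Icc (0 : ℝ) 1

/-- `S` is, near each of its points, a properly embedded locally flat curve in the disk:
in suitable local coordinates `(a, b)` of the plane it is the line `b = 0` (at points of the
open disk), or the disk is the half plane `0 ≤ a` and `S` is the half line `b = 0 ≤ a`. -/
def IsFlatCurve (S : Set (ℝ × ℝ)) : Prop :=
  ∀ p ∈ S, ∃ e : OpenPartialHomeomorph (ℝ × ℝ) (ℝ × ℝ), p ∈ e.source ∧
    ((e.source ⊆ interior disk ∧ ∀ q ∈ e.source, (q ∈ S ↔ (e q).2 = 0)) ∨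
      ∀ q ∈ e.source, (q ∈ disk ↔ 0 ≤ (e q).1) ∧ (q ∈ S ↔ 0 ≤ (e q).1 ∧ (e q).2 = 0))

/-- `S` is, near each of its points, a properly embedded locally flat surface in the cylinder:
in suitable local coordinates `((a, c), b)` of space it is the plane `b = 0` (at interior points
of the cylinder), or the cylinder is the half space `0 ≤ a` and `S` is the half plane
`b = 0 ≤ a`. -/
def IsFlatSurface (S : Set Space) : Prop :=
  ∀ p ∈ S, ∃ e : OpenPartialHomeomorph Space Space, p ∈ e.source ∧
    ((e.source ⊆ interior cylinder ∧ ∀ q ∈ e.source, (q ∈ S ↔ (e q).2 = 0)) ∨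
      ∀ q ∈ e.source, (q ∈ cylinder ↔ 0 ≤ (e q).1.1) ∧
        (q ∈ S ↔ 0 ≤ (e q).1.1 ∧ (e q).2 = 0))

/-- A smoothing with boundary `B`: a compact properly embedded curve in the disk (a finite
disjoint union of simple closed curves and arcs) that meets the circle exactly in `B`. -/
structure Smoothing (B : Finset (ℝ × ℝ)) where
  carrier : Set (ℝ × ℝ)
  isCompact : IsCompact carrier
  subset_disk : carrier ⊆ disk
  inter_circle : carrier ∩ circle = B
  flat : IsFlatCurve carrier

/-- A cobordism from `O` to `O'`: a compact properly embedded surface in the cylinder whose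
boundary consists of `O` at the level `0`, `O'` at the level `1`, and the vertical segments
over the points of `B`. -/
structure Cobordism {B : Finset (ℝ × ℝ)} (O O' : Smoothing B) where
  carrier : Set Space
  isCompact : IsCompact carrier
  subset_cylinder : carrier ⊆ cylinder
  inter_frontier : carrier ∩ frontier cylinder =
    O.carrier ×ˢ {(0 : ℝ)} ∪ O'.carrier ×ˢ {(1 : ℝ)} ∪ (B : Set (ℝ × ℝ)) ×ˢ Set.Icc (0 : ℝ) 1
  flat : IsFlatSurface carrier

/-- Two subsets of the cylinder are isotopic rel boundary: there is an ambient isotopy, given as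
a level preserving homeomorphism of `[0, 1] × Space`, that starts at the identity, fixes every
point outside the interior of the cylinder at all times, and ends by carrying `S` onto `S'`. -/
def IsotopicRel (S S' : Set Space) : Prop :=
  ∃ Φ : (unitInterval × Space) ≃ₜ (unitInterval × Space),
    (∀ p, (Φ p).1 = p.1) ∧
    (∀ x, Φ (0, x) = (0, x)) ∧
    (∀ s x, x ∉ interior cylinder → Φ (s, x) = (s, x)) ∧
    (∀ x, x ∈ S ↔ (Φ (1, x)).2 ∈ S')

theorem IsotopicRel.refl (S : Set Space) : IsotopicRel S S :=
  ⟨Homeomorph.refl _, fun _ => rfl, fun _ => rfl, fun _ _ _ => rfl, fun _ => Iff.rfl⟩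

theorem IsotopicRel.symm {S S' : Set Space} (h : IsotopicRel S S') : IsotopicRel S' S := by
  obtain ⟨Φ, h1, h2, h3, h4⟩ := h
  refine ⟨Φ.symm, fun p => ?_, fun x => ?_, fun s x hx => ?_, fun x => ?_⟩
  · have := h1 (Φ.symm p)
    rw [Φ.apply_symm_apply] at this
    exact this.symm
  · rw [Homeomorph.symm_apply_eq, h2]
  · rw [Homeomorph.symm_apply_eq, h3 s x hx]
  · have e1 : (Φ.symm (1, x)).1 = 1 := by
      have := h1 (Φ.symm (1, x))
      rw [Φ.apply_symm_apply] at this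
      exact this.symm
    have e2 : ((1 : unitInterval), (Φ.symm (1, x)).2) = Φ.symm (1, x) := Prod.ext e1.symm rfl
    rw [h4, e2, Φ.apply_symm_apply]

theorem IsotopicRel.trans {S S' S'' : Set Space} (h : IsotopicRel S S')
    (k : IsotopicRel S' S'') : IsotopicRel S S'' := by
  obtain ⟨Φ, h1, h2, h3, h4⟩ := h
  obtain ⟨Ψ, k1, k2, k3, k4⟩ := k
  refine ⟨Φ.trans Ψ, fun p => ?_, fun x => ?_, fun s x hx => ?_, fun x => ?_⟩
  · rw [Homeomorph.trans_apply, k1, h1]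
  · rw [Homeomorph.trans_apply, h2, k2]
  · rw [Homeomorph.trans_apply, h3 s x hx, k3 s x hx]
  · have e1 : (Φ (1, x)).1 = 1 := h1 (1, x)
    have e2 : ((1 : unitInterval), (Φ (1, x)).2) = Φ (1, x) := Prod.ext e1.symm rfl
    rw [h4, k4, Homeomorph.trans_apply, e2]

/-- Isotopy rel boundary, as an equivalence relation on cobordisms. -/
instance isotopySetoid {B : Finset (ℝ × ℝ)} (O O' : Smoothing B) : Setoid (Cobordism O O') where
  r C C' := IsotopicRel C.carrier C'.carrier
  iseqv := ⟨fun C => IsotopicRel.refl C.carrier, fun h => h.symm, fun h k => h.trans k⟩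

/-- The set of morphisms from `O` to `O'` in the cobordism category of the cylinder. -/
abbrev Mor {B : Finset (ℝ × ℝ)} (O O' : Smoothing B) : Type := Quotient (isotopySetoid O O')

/-- The class of a cobordism in the free `R`-module on the morphisms from `O` to `O'`, that is,
in the module of formal `R`-linear combinations of morphisms. -/
noncomputable def cls (R : Type*) [CommRing R] {B : Finset (ℝ × ℝ)} {O O' : Smoothing B}
    (C : Cobordism O O') : Mor O O' →₀ R :=
  Finsupp.single (Quotient.mk (isotopySetoid O O') C) 1

/-- `e` parametrizes a neighbourhood of a ball in the interior of the cylinder by a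
neighbourhood of the model ball `K`. -/
def IsBallChart (e : OpenPartialHomeomorph Space Space) (K : Set Space) : Prop :=
  K ⊆ e.source ∧ e '' K ⊆ interior cylinder

/-- Inside the ball `e(K)` the set `X` is the model picture `P`; outside it `X` is `C`. -/
def IsReplacement (e : OpenPartialHomeomorph Space Space) (K P C X : Set Space) : Prop :=
  (∀ q ∈ K, (e q ∈ X ↔ q ∈ P)) ∧ ∀ x, x ∉ e '' K → (x ∈ X ↔ x ∈ C)

/-- The two parallel planes `y = 3` and `y = -3`. -/
def sheets : Set Space := {p | |p.1.2| = 3}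

/-- The two planes with a tube attached to them in the slab between them.  The tube runs along
the curve `v = 0` of the plane `t = 0` and consists of the points of the slab with
`v ^ 2 + t ^ 2 = (1 / 4) ^ 2`; the two disks of the planes that it surrounds are removed. -/
def tubed (v : ℝ → ℝ → ℝ) : Set Space :=
  {p | (|p.1.2| = 3 ∧ 1 / 16 ≤ v p.1.1 p.1.2 ^ 2 + p.2 ^ 2) ∨
    (|p.1.2| ≤ 3 ∧ v p.1.1 p.1.2 ^ 2 + p.2 ^ 2 = 1 / 16)}

/-- A straight vertical tube, from the upper plane to the lower one, at `x = a`. -/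
def tubeVertical (a : ℝ) : Set Space := tubed fun x _ => x - a

/-- A tube from the upper plane to itself: it leaves the upper plane at `x = -1`, goes straight
down, turns around along the curve `y = 1 + |x|` and returns straight up to the upper plane at
`x = 1`.  It stays in the half space `0 < y`. -/
def tubeUpper : Set Space := tubed fun x y => |x| - min (y - 1) 1

/-- The mirror image of `tubeUpper`: a tube from the lower plane to itself. -/
def tubeLower : Set Space := tubed fun x y => |x| - min (-y - 1) 1

/-- The model ball of the neck cutting relation, a box.  It meets the two planes in two disks,
an upper and a lower one.  In this ball `tubeVertical 0` is a neck that joins the two disks,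
`tubeUpper` consists of the upper disk with an unknotted handle added and the lower disk, and
`tubeLower` of the upper disk and the lower disk with an unknotted handle added. -/
def neckBall : Set Space := {p | |p.1.1| ≤ 2 ∧ |p.1.2| ≤ 4 ∧ |p.2| ≤ 1}

/-- The model ball of the four tube relation, an hourglass-shaped box.  It meets the two planes
in four disks, the rectangles `1 / 2 ≤ |x| ≤ 2`, `|t| ≤ 1`, `|y| = 3`:
`D₁` (upper left), `D₂` (upper right), `D₃` (lower left) and `D₄` (lower right).
In this ball `tubeUpper`, `tubeLower`, `tubeVertical (-1)` and `tubeVertical 1` are the results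
of replacing `D₁, D₂`, respectively `D₃, D₄`, `D₁, D₃` and `D₂, D₄`, by a tube with the same
boundary. -/
def fourBall : Set Space :=
  {p | |p.1.1| ≤ 2 ∧ |p.1.2| ≤ 4 ∧ |p.1.2| ≤ 2 + 2 * |p.1.1| ∧ |p.2| ≤ 1}

/-- The neck cutting relators: all `2 N - H₁ - H₂`, where `N`, `H₁`, `H₂` come from a cobordism
`C` and a ball in the cylinder that meets `C` in two disks, by joining the two disks by a neck,
by adding a handle to the first disk, and by adding a handle to the second disk. -/
def neckCuttingRelators (R : Type*) [CommRing R] {B : Finset (ℝ × ℝ)} (O O' : Smoothing B) :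
    Set (Mor O O' →₀ R) :=
  {r | ∃ (e : OpenPartialHomeomorph Space Space) (C N H₁ H₂ : Cobordism O O'),
    IsBallChart e neckBall ∧
    IsReplacement e neckBall sheets C.carrier C.carrier ∧
    IsReplacement e neckBall (tubeVertical 0) C.carrier N.carrier ∧
    IsReplacement e neckBall tubeUpper C.carrier H₁.carrier ∧
    IsReplacement e neckBall tubeLower C.carrier H₂.carrier ∧
    r = (2 : R) • cls R N - (cls R H₁ + cls R H₂)}

/-- The four tube relators: all `C₁₂ + C₃₄ - C₁₃ - C₂₄`, where `C` is a cobordism, a ball in the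
cylinder meets `C` in four disks `D₁, …, D₄`, and `Cᵢⱼ` is obtained from `C` by replacing `Dᵢ`
and `Dⱼ` by a tube in the ball with the same boundary. -/
def fourTubeRelators (R : Type*) [CommRing R] {B : Finset (ℝ × ℝ)} (O O' : Smoothing B) :
    Set (Mor O O' →₀ R) :=
  {r | ∃ (e : OpenPartialHomeomorph Space Space) (C C₁₂ C₃₄ C₁₃ C₂₄ : Cobordism O O'),
    IsBallChart e fourBall ∧
    IsReplacement e fourBall sheets C.carrier C.carrier ∧
    IsReplacement e fourBall tubeUpper C.carrier C₁₂.carrier ∧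
    IsReplacement e fourBall tubeLower C.carrier C₃₄.carrier ∧
    IsReplacement e fourBall (tubeVertical (-1)) C.carrier C₁₃.carrier ∧
    IsReplacement e fourBall (tubeVertical 1) C.carrier C₂₄.carrier ∧
    r = (cls R C₁₂ + cls R C₃₄) - (cls R C₁₃ + cls R C₂₄)}

end Bar

namespace Bar

/-! Neck cutting follows from 4Tu over any ring. The hourglass `fourBall` sits inside `neckBall` and
cuts the two disks there into four. A tube between the two upper pieces is a handle on the upper
disk, one between the two lower pieces is a handle on the lower disk, and a tube on the left or
right side is a neck, which slides to the central one. So 4Tu reads `H₁ + H₂ = N + N`; the slide is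
`exists_isReplacement_tubeVertical`.

Conversely, let `Xᵢ` be `C` with a small handle on `Dᵢ`. Each tube of a 4Tu picture is a neck
between two of the disks, so neck cutting gives `2 Cᵢⱼ = Xᵢ + Xⱼ`. Both `2 (C₁₂ + C₃₄)` and `2 (C₁₃
+ C₂₄)` equal the sum of all `Xᵢ`, and 2 can be divided out. To apply neck cutting, a neck ball must
be placed around each tube. `squeeze` does this for the left vertical tube (`vertical_relator_mem`),
and `bend` carries that ball around the upper tube while fixing the handle on `D₁`
(`upper_relator_mem`). Reflections give the other two tubes.

The auxiliary cobordisms must be shown to exist. `exists_isReplacement` reduces this to local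
flatness of the model picture, which is never checked by hand: it is transported by homeomorphisms
from tubes in cobordisms that are already given. -/

open Set

variable {B : Finset (ℝ × ℝ)} {O O' : Smoothing B}

/-! ### Local flatness and replacement inside a ball -/

/-- Near `q`, the set `P` is a locally flat surface in space. -/
def IsFlatAt (P : Set Space) (q : Space) : Prop :=
  ∃ φ : OpenPartialHomeomorph Space Space, q ∈ φ.source ∧
    ∀ x ∈ φ.source, (x ∈ P ↔ (φ x).2 = 0)

theorem IsFlatAt.preimage {P : Set Space} {q : Space} (f : Space ≃ₜ Space)
    (h : IsFlatAt P (f q)) : IsFlatAt (f ⁻¹' P) q := by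
  obtain ⟨φ, hq, h⟩ := h
  exact ⟨f.transOpenPartialHomeomorph φ, hq, fun x hx => h (f x) hx⟩

/-- A model picture inherits flatness from a cobordism which contains it. -/
theorem IsReplacement.isFlatAt {e : OpenPartialHomeomorph Space Space} {K U P C : Set Space}
    {X : Cobordism O O'} (he : IsBallChart e K) (hX : IsReplacement e K P C X.carrier)
    (hU : IsOpen U) (hUK : U ⊆ K) {q : Space} (hq : q ∈ U) (hqP : q ∈ P) : IsFlatAt P q := by
  obtain ⟨φ, hφ, h⟩ := X.flat (e q) ((hX.1 q (hUK hq)).2 hqP)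
  refine ⟨(e.restrOpen U hU).trans φ, ⟨⟨he.1 (hUK hq), hq⟩, hφ⟩, ?_⟩
  rintro x ⟨⟨-, hxU⟩, hxφ⟩
  have hxK := hUK hxU
  replace hxφ : e x ∈ φ.source := hxφ
  rw [← hX.1 x hxK]
  change e x ∈ X.carrier ↔ (φ (e x)).2 = 0
  rcases h with ⟨-, h⟩ | h
  · exact h _ hxφ
  -- In a boundary chart the condition `0 ≤ a` is automatic here, because the ball lies in the
  -- interior of the cylinder.
  · rw [(h _ hxφ).2]
    have := ((h _ hxφ).1).1 (interior_subset (he.2 ⟨x, hxK, rfl⟩))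
    exact ⟨fun h => h.2, fun h => ⟨this, h⟩⟩

theorem IsBallChart.comp {e f : OpenPartialHomeomorph Space Space} {K K' : Set Space}
    (he : IsBallChart e K) (hf : K' ⊆ f.source) (hK : MapsTo f K' K) :
    IsBallChart (f.trans e) K' := by
  refine ⟨fun q hq => ⟨hf hq, he.1 (hK hq)⟩, ?_⟩
  rintro _ ⟨q, hq, rfl⟩
  exact he.2 ⟨f q, hK hq, rfl⟩

/-- Replacements may be viewed in a smaller ball that contains all changes. -/
theorem IsReplacement.comp {e f : OpenPartialHomeomorph Space Space}
    {K K' L P P' S C X : Set Space} (hX : IsReplacement e K P C X)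
    (hC : IsReplacement e K S C C) (hK : MapsTo f K' K) (hL : L ⊆ f '' K')
    (hP : ∀ q, q ∉ L → (q ∈ P ↔ q ∈ S)) (hP' : ∀ q ∈ K', (f q ∈ P ↔ q ∈ P')) :
    IsReplacement (f.trans e) K' P' C X := by
  refine ⟨fun q hq => (hX.1 (f q) (hK hq)).trans (hP' q hq), fun x hx => ?_⟩
  by_cases hxK : x ∈ e '' K
  · obtain ⟨q, hq, rfl⟩ := hxK
    rw [hX.1 q hq, hC.1 q hq]
    refine hP q fun hqL => hx ?_
    obtain ⟨p, hp, rfl⟩ := hL hqL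
    exact ⟨p, hp, rfl⟩
  · exact hX.2 x hxK

/-- Replacing the picture inside a ball by another locally flat one yields a cobordism. -/
theorem exists_isReplacement {e : OpenPartialHomeomorph Space Space} {K L U P S : Set Space}
    (C : Cobordism O O') (he : IsBallChart e K) (hC : IsReplacement e K S C.carrier C.carrier)
    (hK : IsCompact K) (hL : IsCompact L) (hU : IsOpen U) (hLU : L ⊆ U) (hUK : U ⊆ K)
    (hP : IsClosed P) (hPS : ∀ q, q ∉ L → (q ∈ P ↔ q ∈ S))
    (hflat : ∀ q ∈ L, q ∈ P → IsFlatAt P q) :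
    ∃ X : Cobordism O O', IsReplacement e K P C.carrier X.carrier := by
  -- Only the image of the open set `U` is removed, so that what remains of `C` is compact. The
  -- collar `K \ U` belongs to both pieces, where they agree.
  set X : Set Space := (C.carrier \ e '' U) ∪ e '' (K ∩ P)
  have hinj : ∀ p ∈ K, ∀ q ∈ K, e p = e q → p = q := fun p hp q hq h =>
    e.injOn (he.1 hp) (he.1 hq) h
  have hX : IsReplacement e K P C.carrier X := by
    refine ⟨fun q hq => ⟨?_, fun h => Or.inr ⟨q, ⟨hq, h⟩, rfl⟩⟩, fun x hx => ⟨?_, ?_⟩⟩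
    · rintro (⟨h1, h2⟩ | ⟨p, ⟨hp, hpP⟩, hpq⟩)
      · have : q ∉ L := fun h => h2 ⟨q, hLU h, rfl⟩
        exact (hPS q this).2 ((hC.1 q hq).1 h1)
      · rwa [← hinj p hp q hq hpq]
    · rintro (h | ⟨p, ⟨hp, -⟩, rfl⟩)
      · exact h.1
      · exact absurd ⟨p, hp, rfl⟩ hx
    · exact fun h => Or.inl ⟨h, fun h' => hx (image_mono hUK h')⟩
  have hXL : ∀ x, x ∉ e '' L → (x ∈ X ↔ x ∈ C.carrier) := by
    intro x hx
    by_cases hxK : x ∈ e '' K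
    · obtain ⟨q, hq, rfl⟩ := hxK
      rw [hX.1 q hq, hC.1 q hq]
      exact hPS q fun h => hx ⟨q, h, rfl⟩
    · exact hX.2 x hxK
  have hXi : ∀ x, x ∉ interior cylinder → (x ∈ X ↔ x ∈ C.carrier) := fun x hx =>
    hX.2 x fun h => hx (he.2 h)
  have heU : IsOpen (e '' U) := e.isOpen_image_of_subset_source hU (hUK.trans he.1)
  refine ⟨⟨X, ?_, ?_, ?_, ?_⟩, hX⟩
  · exact (C.isCompact.diff heU).union
      ((hK.inter_right hP).image_of_continuousOn
        (e.continuousOn.mono (inter_subset_left.trans he.1)))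
  · rintro x (hx | ⟨q, ⟨hq, -⟩, rfl⟩)
    · exact C.subset_cylinder hx.1
    · exact interior_subset (he.2 ⟨q, hq, rfl⟩)
  · rw [← C.inter_frontier]
    ext x
    exact and_congr_left fun hx => hXi x hx.2
  · intro x hx
    -- On `e '' L` a chart of the model is pushed forward by `e`. Elsewhere `X` agrees with `C` on
    -- the open complement of the compact set `e '' L`, so a chart of `C` is restricted.
    by_cases hxL : x ∈ e '' L
    · obtain ⟨q, hq, rfl⟩ := hxL
      have hqK := hUK (hLU hq)
      obtain ⟨φ, hφq, hφ⟩ := hflat q hq ((hX.1 q hqK).1 hx)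
      have hmap : MapsTo e U (interior cylinder) := fun y hy => he.2 ⟨y, hUK hy, rfl⟩
      refine ⟨(e.restrOpen U hU).symm.trans φ, ⟨?_, ?_⟩, Or.inl ⟨?_, ?_⟩⟩
      · exact (e.restrOpen U hU).map_source ⟨he.1 hqK, hLU hq⟩
      · change e.symm (e q) ∈ φ.source
        rwa [e.left_inv (he.1 hqK)]
      · rintro y ⟨hy, -⟩
        have h1 := (e.restrOpen U hU).map_target hy
        have h2 := (e.restrOpen U hU).right_inv hy
        rw [← h2]
        exact hmap h1.2
      · rintro y ⟨hy, hyφ⟩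
        have h1 : e.symm y ∈ e.source ∩ U := (e.restrOpen U hU).map_target hy
        have h2 : e (e.symm y) = y := (e.restrOpen U hU).right_inv hy
        change y ∈ X ↔ (φ (e.symm y)).2 = 0
        rw [← hφ (e.symm y) hyφ, ← hX.1 _ (hUK h1.2), h2]
    · obtain ⟨φ, hφ, h⟩ := C.flat x ((hXL x hxL).1 hx)
      have hopen : IsOpen (e '' L)ᶜ :=
        (hL.image_of_continuousOn
          (e.continuousOn.mono ((hLU.trans hUK).trans he.1))).isClosed.isOpen_compl
      refine ⟨φ.restrOpen _ hopen, ⟨hφ, hxL⟩, h.imp ?_ ?_⟩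
      · rintro ⟨h1, h2⟩
        exact ⟨inter_subset_left.trans h1, fun y hy => (hXL y hy.2).trans (h2 y hy.1)⟩
      · exact fun h1 y hy => ⟨(h1 y hy.1).1, (hXL y hy.2).trans (h1 y hy.1).2⟩

/-! ### Extending model isotopies by the identity -/

/-- Transport of a self-map of the model along a chart, extended by the identity. -/
noncomputable def extendMap (e : OpenPartialHomeomorph Space Space) (K : Set Space)
    (Φ : unitInterval × Space → unitInterval × Space) (p : unitInterval × Space) :
    unitInterval × Space := by
  classical
  exact if p.2 ∈ e '' K then (p.1, e (Φ (p.1, e.symm p.2)).2) else p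

section extend

variable {e : OpenPartialHomeomorph Space Space} {K U : Set Space}
  {Φ Ψ : unitInterval × Space → unitInterval × Space}

theorem extendMap_image (he : K ⊆ e.source) {q : Space} (hq : q ∈ K) (s : unitInterval) :
    extendMap e K Φ (s, e q) = (s, e (Φ (s, q)).2) := by
  simp only [extendMap]
  rw [if_pos ⟨q, hq, rfl⟩, e.left_inv (he hq)]

theorem extendMap_of_notMem {x : Space} (hx : x ∉ e '' K) (s : unitInterval) :
    extendMap e K Φ (s, x) = (s, x) := by
  simp only [extendMap]
  rw [if_neg hx]

theorem extendMap_fst (p : unitInterval × Space) : (extendMap e K Φ p).1 = p.1 := by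
  simp only [extendMap]
  split_ifs <;> rfl

/-- The closed sets `e '' K` and `(e '' U)ᶜ` cover space. The map is continuous on the first through
the chart and is the identity on the second, so the two pieces glue. -/
theorem continuous_extendMap (he : K ⊆ e.source) (hK : IsCompact K) (hU : IsOpen U)
    (hUK : U ⊆ K) (hΦ : Continuous Φ) (hfix : ∀ s x, x ∉ U → Φ (s, x) = (s, x))
    (hmaps : ∀ s x, x ∈ K → (Φ (s, x)).2 ∈ K) : Continuous (extendMap e K Φ) := by
  have heU : IsOpen (e '' U) := e.isOpen_image_of_subset_source hU (hUK.trans he)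
  have heK : IsClosed (e '' K) := (hK.image_of_continuousOn (e.continuousOn.mono he)).isClosed
  have h1 : ContinuousOn (extendMap e K Φ) (univ ×ˢ (e '' K)) := by
    have : ContinuousOn (fun p : unitInterval × Space => (p.1, e (Φ (p.1, e.symm p.2)).2))
        (univ ×ˢ (e '' K)) := by
      refine continuousOn_fst.prodMk ?_
      refine e.continuousOn.comp (t := e.source) ?_ ?_
      · refine continuous_snd.comp_continuousOn (hΦ.comp_continuousOn ?_)
        refine continuousOn_fst.prodMk ?_
        refine e.continuousOn_symm.comp continuousOn_snd ?_
        rintro ⟨s, x⟩ ⟨-, q, hq, hx⟩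
        simp only at hx
        rw [← hx]
        exact e.map_source (he hq)
      · rintro ⟨s, x⟩ ⟨-, q, hq, hx⟩
        simp only at hx
        simp only [← hx, e.left_inv (he hq)]
        exact he (hmaps s q hq)
    refine this.congr ?_
    rintro ⟨s, x⟩ ⟨-, hx⟩
    simp only [extendMap]
    rw [if_pos hx]
  have h2 : ContinuousOn (extendMap e K Φ) (univ ×ˢ (e '' U)ᶜ) := by
    refine continuousOn_id.congr ?_
    rintro ⟨s, x⟩ ⟨-, hx⟩
    by_cases hxK : x ∈ e '' K
    · obtain ⟨q, hq, rfl⟩ := hxK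
      rw [extendMap_image he hq, hfix s q fun h => hx ⟨q, h, rfl⟩]
      rfl
    · exact extendMap_of_notMem hxK s
  have h3 := h1.union_of_isClosed h2 (isClosed_univ.prod heK) (isClosed_univ.prod heU.isClosed_compl)
  rw [← prod_union] at h3
  have : e '' K ∪ (e '' U)ᶜ = univ := by
    rw [eq_univ_iff_forall]
    intro x
    by_cases h : x ∈ e '' U
    · exact Or.inl (image_mono hUK h)
    · exact Or.inr h
  rwa [this, univ_prod_univ, continuousOn_univ] at h3

theorem extendMap_extendMap (he : K ⊆ e.source) (hmaps : ∀ s x, x ∈ K → (Φ (s, x)).2 ∈ K)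
    (hfst : ∀ p, (Φ p).1 = p.1) (hinv : ∀ p, Ψ (Φ p) = p) (p : unitInterval × Space) :
    extendMap e K Ψ (extendMap e K Φ p) = p := by
  obtain ⟨s, x⟩ := p
  by_cases hx : x ∈ e '' K
  · obtain ⟨q, hq, rfl⟩ := hx
    rw [extendMap_image he hq, extendMap_image he (hmaps s q hq)]
    have : (s, (Φ (s, q)).2) = Φ (s, q) := Prod.ext (hfst (s, q)).symm rfl
    rw [this, hinv]
  · rw [extendMap_of_notMem hx, extendMap_of_notMem hx]

end extend

/-- An isotopy of the model with support in the ball induces an isotopy of replacements. -/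
theorem IsReplacement.isotopicRel {e : OpenPartialHomeomorph Space Space}
    {K U P P' C X X' : Set Space} (he : IsBallChart e K) (hX : IsReplacement e K P C X)
    (hX' : IsReplacement e K P' C X') (hK : IsCompact K) (hU : IsOpen U) (hUK : U ⊆ K)
    (Φ : (unitInterval × Space) ≃ₜ (unitInterval × Space)) (hfst : ∀ p, (Φ p).1 = p.1)
    (hzero : ∀ x, Φ (0, x) = (0, x)) (hfix : ∀ s x, x ∉ U → Φ (s, x) = (s, x))
    (hP : ∀ q ∈ K, (q ∈ P ↔ (Φ (1, q)).2 ∈ P')) : IsotopicRel X X' := by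
  have hfst' : ∀ p, (Φ.symm p).1 = p.1 := fun p => by
    rw [← hfst (Φ.symm p), Φ.apply_symm_apply]
  have hfix' : ∀ s x, x ∉ U → Φ.symm (s, x) = (s, x) := fun s x hx => by
    rw [Homeomorph.symm_apply_eq, hfix s x hx]
  have key : ∀ Ψ : (unitInterval × Space) ≃ₜ (unitInterval × Space),
      (∀ p, (Ψ.symm p).1 = p.1) → (∀ s x, x ∉ U → Ψ.symm (s, x) = (s, x)) →
      (∀ p, (Ψ p).1 = p.1) → ∀ s x, x ∈ K → (Ψ (s, x)).2 ∈ K := by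
    intro Ψ h1 h2 h3 s x hx
    -- A point of `K` sent outside `K` would land outside `U`, where the inverse is the identity; it
    -- would then have started outside `K`.
    by_contra hn
    have e1 : (s, (Ψ (s, x)).2) = Ψ (s, x) := Prod.ext (h3 (s, x)).symm rfl
    have := h2 s _ (fun h => hn (hUK h))
    rw [e1, Ψ.symm_apply_apply] at this
    rw [← this] at hn
    exact hn hx
  have hm := key Φ hfst' hfix' hfst
  have hm' := key Φ.symm hfst hfix hfst'
  refine ⟨⟨⟨extendMap e K Φ, extendMap e K Φ.symm,
      extendMap_extendMap he.1 hm hfst Φ.symm_apply_apply,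
      extendMap_extendMap he.1 hm' hfst' Φ.apply_symm_apply⟩,
      continuous_extendMap he.1 hK hU hUK Φ.continuous hfix hm,
      continuous_extendMap he.1 hK hU hUK Φ.symm.continuous hfix' hm'⟩,
    extendMap_fst, fun x => ?_, fun s x hx => ?_, fun x => ?_⟩
  · change extendMap e K Φ (0, x) = (0, x)
    by_cases hx : x ∈ e '' K
    · obtain ⟨q, hq, rfl⟩ := hx
      rw [extendMap_image he.1 hq, hzero]
    · exact extendMap_of_notMem hx 0
  · exact extendMap_of_notMem (fun h => hx (he.2 h)) s
  · change x ∈ X ↔ (extendMap e K Φ (1, x)).2 ∈ X'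
    by_cases hx : x ∈ e '' K
    · obtain ⟨q, hq, rfl⟩ := hx
      rw [extendMap_image he.1 hq, hX.1 q hq, hP q hq, hX'.1 _ (hm 1 q hq)]
    · rw [extendMap_of_notMem hx, hX.2 x hx, hX'.2 x hx]

/-! ### Solid tubes and the two model balls -/

/-- The solid tube bounded by the tube of `tubed v`. -/
def solidTube (v : ℝ → ℝ → ℝ) : Set Space :=
  {p | |p.1.2| ≤ 3 ∧ v p.1.1 p.1.2 ^ 2 + p.2 ^ 2 ≤ 1 / 16}

/-- This bounds the support of a tube surgery: a ball containing the solid tube sees the whole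
change, which permits passing to smaller balls. -/
theorem mem_tubed_iff_mem_sheets {v : ℝ → ℝ → ℝ} {q : Space} (hq : q ∉ solidTube v) :
    q ∈ tubed v ↔ q ∈ sheets := by
  simp only [solidTube, tubed, sheets, mem_ofPred_eq, not_and, not_le] at *
  constructor
  · rintro (h | h)
    · exact h.1
    · exact absurd h.2 (hq h.1).ne'
  · exact fun h => Or.inl ⟨h, (hq h.le).le⟩

theorem isClosed_tubed {v : ℝ → ℝ → ℝ} (hv : Continuous fun p : ℝ × ℝ => v p.1 p.2) :
    IsClosed (tubed v) := by
  have hv' : Continuous fun p : Space => v p.1.1 p.1.2 := hv.comp continuous_fst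
  refine IsClosed.union (IsClosed.and ?_ ?_) (IsClosed.and ?_ ?_)
  · exact isClosed_eq (by fun_prop) (by fun_prop)
  · exact isClosed_le (by fun_prop) (by fun_prop)
  · exact isClosed_le (by fun_prop) (by fun_prop)
  · exact isClosed_eq (by fun_prop) (by fun_prop)

theorem isClosed_solidTube {v : ℝ → ℝ → ℝ} (hv : Continuous fun p : ℝ × ℝ => v p.1 p.2) :
    IsClosed (solidTube v) := by
  have hv' : Continuous fun p : Space => v p.1.1 p.1.2 := hv.comp continuous_fst
  exact IsClosed.and (isClosed_le (by fun_prop) (by fun_prop))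
    (isClosed_le (by fun_prop) (by fun_prop))

theorem abs_le_of_mem_solidTube {v : ℝ → ℝ → ℝ} {q : Space} (hq : q ∈ solidTube v) :
    |q.1.2| ≤ 3 ∧ |v q.1.1 q.1.2| ≤ 1 / 4 ∧ |q.2| ≤ 1 / 4 := by
  obtain ⟨h1, h2⟩ := hq
  exact ⟨h1, abs_le_of_sq_le_sq (by nlinarith [sq_nonneg q.2]) (by norm_num),
    abs_le_of_sq_le_sq (by nlinarith [sq_nonneg (v q.1.1 q.1.2)]) (by norm_num)⟩

/-- The interior of `neckBall`. -/
def neckInterior : Set Space := {p | |p.1.1| < 2 ∧ |p.1.2| < 4 ∧ |p.2| < 1}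

/-- The interior of `fourBall`. -/
def fourInterior : Set Space :=
  {p | |p.1.1| < 2 ∧ |p.1.2| < 4 ∧ |p.1.2| < 2 + 2 * |p.1.1| ∧ |p.2| < 1}

theorem isOpen_neckInterior : IsOpen neckInterior := by
  refine IsOpen.and ?_ (IsOpen.and ?_ ?_) <;> exact isOpen_lt (by fun_prop) (by fun_prop)

theorem isOpen_fourInterior : IsOpen fourInterior := by
  refine IsOpen.and ?_ (IsOpen.and ?_ (IsOpen.and ?_ ?_)) <;>
    exact isOpen_lt (by fun_prop) (by fun_prop)

theorem neckInterior_subset : neckInterior ⊆ neckBall := fun _ h =>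
  ⟨h.1.le, h.2.1.le, h.2.2.le⟩

theorem fourInterior_subset : fourInterior ⊆ fourBall := fun _ h =>
  ⟨h.1.le, h.2.1.le, h.2.2.1.le, h.2.2.2.le⟩

theorem isCompact_neckBall : IsCompact neckBall := by
  refine ((isCompact_Icc (a := (-2 : ℝ)) (b := 2)).prod (isCompact_Icc (a := (-4 : ℝ))
    (b := 4))).prod (isCompact_Icc (a := (-1 : ℝ)) (b := 1)) |>.of_isClosed_subset ?_ ?_
  · refine IsClosed.and ?_ (IsClosed.and ?_ ?_) <;> exact isClosed_le (by fun_prop) (by fun_prop)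
  · exact fun p h => ⟨⟨abs_le.1 h.1, abs_le.1 h.2.1⟩, abs_le.1 h.2.2⟩

theorem fourBall_subset_neckBall : fourBall ⊆ neckBall := fun _ h => ⟨h.1, h.2.1, h.2.2.2⟩

theorem isCompact_fourBall : IsCompact fourBall := by
  refine isCompact_neckBall.of_isClosed_subset ?_ fourBall_subset_neckBall
  refine IsClosed.and ?_ (IsClosed.and ?_ (IsClosed.and ?_ ?_)) <;>
    exact isClosed_le (by fun_prop) (by fun_prop)

theorem solidTube_vertical_subset_neckInterior {a : ℝ} (ha : |a| ≤ 1) :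
    solidTube (fun x _ => x - a) ⊆ neckInterior := by
  intro q hq
  obtain ⟨h1, h2, h3⟩ := abs_le_of_mem_solidTube hq
  refine ⟨?_, by linarith, by linarith⟩
  rw [abs_le] at *
  rw [abs_lt]
  constructor <;> linarith

/-- The tube has radius 1/4, so `|x| ≥ 3 / 4` on it. There the hourglass has half-height above `2 +
2 * (3 / 4) - 0 = 7 / 2` or equal to it, which exceeds 3. -/
theorem solidTube_vertical_subset_fourInterior {a : ℝ} (ha : |a| = 1) :
    solidTube (fun x _ => x - a) ⊆ fourInterior := by
  intro q hq
  obtain ⟨h1, h2, h3⟩ := abs_le_of_mem_solidTube hq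
  have h4 := abs_sub_abs_le_abs_sub a q.1.1
  have h5 := abs_sub_abs_le_abs_sub q.1.1 a
  rw [abs_sub_comm] at h4
  exact ⟨by linarith, by linarith, by linarith, by linarith⟩

theorem solidTube_upper_subset_fourInterior :
    solidTube (fun x y => |x| - min (y - 1) 1) ⊆ fourInterior := by
  intro q hq
  obtain ⟨h1, h2, h3⟩ := abs_le_of_mem_solidTube hq
  simp only [fourInterior, mem_ofPred_eq]
  have := abs_nonneg q.1.1
  rw [abs_le] at h1 h2
  rcases min_cases (q.1.2 - 1) 1 with ⟨h, h'⟩ | ⟨h, h'⟩ <;> rw [h] at h2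
  all_goals
    rw [abs_of_nonneg (by linarith : 0 ≤ q.1.2)]
    exact ⟨by linarith, by linarith, by linarith, by linarith⟩

theorem continuous_upper : Continuous fun p : ℝ × ℝ => |p.1| - min (p.2 - 1) 1 := by fun_prop

/-! ### Sliding a vertical tube sideways -/

theorem max_min_min_eq {p q b : ℝ} (h0 : 0 ≤ b) (h1 : b ≤ 1) (hp : b ≤ p) (hq : b ≤ q)
    (h : b = 1 ∨ b = p ∨ b = q) : max 0 (min 1 (min p q)) = b := by
  rw [max_eq_right (le_min zero_le_one (le_min (h0.trans hp) (h0.trans hq)))]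
  apply le_antisymm _ (le_min h1 (le_min hp hq))
  rcases h with h | h | h <;> rw [h] <;> simp

theorem max_min_min_eq_zero {p q : ℝ} (h : p ≤ 0 ∨ q ≤ 0) : max 0 (min 1 (min p q)) = 0 := by
  rw [max_eq_left]
  rcases h with h | h <;> simp [h]

/-- A piecewise linear homeomorphism of the line that is supported in `[-2, 2]` and translates
`[-1/4, 1/4]` by `A`. -/
noncomputable def slide (A x : ℝ) : ℝ :=
  x + A * max 0 (min 1 (min ((2 - x) * (4 / 7)) ((2 + x) * (4 / 7))))

/-- The inverse of `slide A`. -/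
noncomputable def unslide (A y : ℝ) : ℝ :=
  y - A * max 0 (min 1 (min ((2 - y) / (7 / 4 - A)) ((2 + y) / (7 / 4 + A))))

theorem slide_eq {A x b : ℝ} (h0 : 0 ≤ b) (h1 : b ≤ 1) (hp : b ≤ (2 - x) * (4 / 7))
    (hq : b ≤ (2 + x) * (4 / 7))
    (h : b = 1 ∨ b = (2 - x) * (4 / 7) ∨ b = (2 + x) * (4 / 7)) : slide A x = x + A * b := by
  rw [slide, max_min_min_eq h0 h1 hp hq h]

theorem unslide_eq {A y b : ℝ} (hA : |A| ≤ 1) (h0 : 0 ≤ b) (h1 : b ≤ 1)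
    (hp : b * (7 / 4 - A) ≤ 2 - y) (hq : b * (7 / 4 + A) ≤ 2 + y)
    (h : b = 1 ∨ b * (7 / 4 - A) = 2 - y ∨ b * (7 / 4 + A) = 2 + y) :
    unslide A y = y - A * b := by
  obtain ⟨hA1, hA2⟩ := abs_le.1 hA
  have hm : 0 < 7 / 4 - A := by linarith
  have hp' : 0 < 7 / 4 + A := by linarith
  rw [unslide, max_min_min_eq h0 h1 ((le_div_iff₀ hm).2 hp) ((le_div_iff₀ hp').2 hq)
    (h.imp_right (Or.imp (eq_div_iff hm.ne').2 (eq_div_iff hp'.ne').2))]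

theorem slide_of_two_le {A x : ℝ} (h : 2 ≤ |x|) : slide A x = x := by
  rw [slide, max_min_min_eq_zero, mul_zero, add_zero]
  rcases le_abs.1 h with h | h
  · left; linarith
  · right; linarith

theorem unslide_of_two_le {A x : ℝ} (hA : |A| ≤ 1) (h : 2 ≤ |x|) : unslide A x = x := by
  obtain ⟨hA1, hA2⟩ := abs_le.1 hA
  rw [unslide, max_min_min_eq_zero, mul_zero, sub_zero]
  rcases le_abs.1 h with h | h
  · left; exact div_nonpos_of_nonpos_of_nonneg (by linarith) (by linarith)
  · right; exact div_nonpos_of_nonpos_of_nonneg (by linarith) (by linarith)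

/-- On each linear piece the cutoff in `unslide` at the image point has the same value `b` as the
cutoff in `slide` at `x`, so the displacements `A * b` cancel. The bound on `A` keeps the outer
pieces from collapsing. -/
theorem unslide_slide {A : ℝ} (hA : |A| ≤ 1) (x : ℝ) : unslide A (slide A x) = x := by
  obtain ⟨hA1, hA2⟩ := abs_le.1 hA
  rcases le_or_gt 2 |x| with h | h
  · rw [slide_of_two_le h, unslide_of_two_le hA h]
  obtain ⟨hx1, hx2⟩ := abs_lt.1 h
  rcases le_total x (1 / 4) with h1 | h1
  · rcases le_total (-1 / 4) x with h2 | h2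
    · rw [slide_eq (b := 1) (by norm_num) (by norm_num) (by linarith) (by linarith)
        (Or.inl rfl), unslide_eq (b := 1) hA (by norm_num) (by norm_num) (by linarith)
        (by linarith) (Or.inl rfl)]
      ring
    · rw [slide_eq (b := (2 + x) * (4 / 7)) (by linarith) (by linarith) (by linarith) le_rfl
        (Or.inr (Or.inr rfl)), unslide_eq (b := (2 + x) * (4 / 7)) hA (by linarith)
        (by linarith) (by nlinarith) (by nlinarith) (Or.inr (Or.inr (by ring)))]
      ring
  · rw [slide_eq (b := (2 - x) * (4 / 7)) (by linarith) (by linarith) le_rfl (by linarith)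
        (Or.inr (Or.inl rfl)), unslide_eq (b := (2 - x) * (4 / 7)) hA (by linarith)
        (by linarith) (by nlinarith) (by nlinarith) (Or.inr (Or.inl (by ring)))]
    ring

theorem slide_unslide {A : ℝ} (hA : |A| ≤ 1) (y : ℝ) : slide A (unslide A y) = y := by
  obtain ⟨hA1, hA2⟩ := abs_le.1 hA
  have hm : 0 < 7 / 4 - A := by linarith
  have hp : 0 < 7 / 4 + A := by linarith
  rcases le_or_gt 2 |y| with h | h
  · rw [unslide_of_two_le hA h, slide_of_two_le h]
  obtain ⟨hx1, hx2⟩ := abs_lt.1 h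
  rcases le_total y (1 / 4 + A) with h1 | h1
  · rcases le_total (-1 / 4 + A) y with h2 | h2
    · rw [unslide_eq (b := 1) hA (by norm_num) (by norm_num) (by linarith)
        (by linarith) (Or.inl rfl), slide_eq (b := 1) (by norm_num) (by norm_num) (by linarith)
        (by linarith) (Or.inl rfl)]
      ring
    · obtain ⟨b, hb⟩ : ∃ b, b * (7 / 4 + A) = 2 + y := ⟨_, div_mul_cancel₀ _ hp.ne'⟩
      have hb0 : 0 ≤ b := by by_contra! hn; nlinarith
      have hb1 : b ≤ 1 := by by_contra! hn; nlinarith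
      rw [unslide_eq (b := b) hA hb0 hb1 (by nlinarith) hb.le (Or.inr (Or.inr hb)),
        slide_eq (b := b) hb0 hb1 (by nlinarith) (by nlinarith)
        (Or.inr (Or.inr (by linarith)))]
      ring
  · obtain ⟨b, hb⟩ : ∃ b, b * (7 / 4 - A) = 2 - y := ⟨_, div_mul_cancel₀ _ hm.ne'⟩
    have hb0 : 0 ≤ b := by by_contra! hn; nlinarith
    have hb1 : b ≤ 1 := by by_contra! hn; nlinarith
    rw [unslide_eq (b := b) hA hb0 hb1 hb.le (by nlinarith) (Or.inr (Or.inl hb)),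
      slide_eq (b := b) hb0 hb1 (by nlinarith) (by nlinarith)
      (Or.inr (Or.inl (by linarith)))]
    ring

/-- Either the point is moved by exactly `A`, or it is farther than the tube radius from the axis
both before and after, and then the exact displacement is irrelevant to tube membership. -/
theorem slide_sub_cases {A : ℝ} (hA : |A| ≤ 1) (x : ℝ) :
    slide A x - A = x ∨ 1 / 16 < (slide A x - A) ^ 2 ∧ 1 / 16 < x ^ 2 := by
  obtain ⟨hA1, hA2⟩ := abs_le.1 hA
  rcases le_or_gt 2 |x| with h | h
  · right
    rw [slide_of_two_le h]
    rcases le_abs.1 h with h | h <;> constructor <;> nlinarith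
  obtain ⟨hx1, hx2⟩ := abs_lt.1 h
  rcases le_or_gt x (1 / 4) with h1 | h1
  · rcases le_or_gt (-1 / 4) x with h2 | h2
    · left
      rw [slide_eq (b := 1) (by norm_num) (by norm_num) (by linarith) (by linarith) (Or.inl rfl)]
      ring
    · right
      rw [slide_eq (b := (2 + x) * (4 / 7)) (by linarith) (by linarith) (by linarith) le_rfl
        (Or.inr (Or.inr rfl))]
      have : x + A * ((2 + x) * (4 / 7)) - A < -1 / 4 := by nlinarith
      constructor <;> nlinarith
  · right
    rw [slide_eq (b := (2 - x) * (4 / 7)) (by linarith) (by linarith) le_rfl (by linarith)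
      (Or.inr (Or.inl rfl))]
    have : 1 / 4 < x + A * ((2 - x) * (4 / 7)) - A := by nlinarith
    constructor <;> nlinarith

/-- The amount of the translation at time `s` in the sliding isotopy. -/
noncomputable def slideAmount (a : ℝ) (p : unitInterval × Space) : ℝ :=
  a * (p.1 * max 0 (min 1 (min (4 - |p.2.1.2|) ((1 - |p.2.2|) * (4 / 3)))))

theorem abs_slideAmount_le {a : ℝ} (ha : |a| ≤ 1) (p : unitInterval × Space) :
    |slideAmount a p| ≤ 1 := by
  have h1 : 0 ≤ max 0 (min 1 (min (4 - |p.2.1.2|) ((1 - |p.2.2|) * (4 / 3)))) := le_max_left _ _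
  have h2 : max 0 (min 1 (min (4 - |p.2.1.2|) ((1 - |p.2.2|) * (4 / 3)))) ≤ 1 :=
    max_le zero_le_one (min_le_left _ _)
  rw [slideAmount, abs_mul, abs_of_nonneg (mul_nonneg p.1.2.1 h1)]
  exact mul_le_one₀ ha (mul_nonneg p.1.2.1 h1) (mul_le_one₀ p.1.2.2 h1 h2)

theorem continuous_slideAmount (a : ℝ) : Continuous (slideAmount a) := by
  unfold slideAmount
  fun_prop

/-- An isotopy that slides the vertical tube at `x = 0` to the vertical tube at `x = a`. -/
noncomputable def slideIsotopy (a : ℝ) (ha : |a| ≤ 1) :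
    (unitInterval × Space) ≃ₜ (unitInterval × Space) where
  toFun p := (p.1, ((slide (slideAmount a p) p.2.1.1, p.2.1.2), p.2.2))
  invFun p := (p.1, ((unslide (slideAmount a p) p.2.1.1, p.2.1.2), p.2.2))
  left_inv p := by
    have := unslide_slide (abs_slideAmount_le ha p) p.2.1.1
    exact Prod.ext rfl (Prod.ext (Prod.ext this rfl) rfl)
  right_inv p := by
    have := slide_unslide (abs_slideAmount_le ha p) p.2.1.1
    exact Prod.ext rfl (Prod.ext (Prod.ext this rfl) rfl)
  continuous_toFun := by
    have := continuous_slideAmount a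
    unfold slide
    fun_prop
  continuous_invFun := by
    have := continuous_slideAmount a
    have h1 : ∀ p, 7 / 4 - slideAmount a p ≠ 0 := fun p => by
      have := abs_le.1 (abs_slideAmount_le ha p); linarith
    have h2 : ∀ p, 7 / 4 + slideAmount a p ≠ 0 := fun p => by
      have := abs_le.1 (abs_slideAmount_le ha p); linarith
    unfold unslide
    fun_prop (disch := assumption)

theorem slideIsotopy_apply {a : ℝ} (ha : |a| ≤ 1) (p : unitInterval × Space) :
    slideIsotopy a ha p = (p.1, ((slide (slideAmount a p) p.2.1.1, p.2.1.2), p.2.2)) := rfl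

theorem slide_zero (x : ℝ) : slide 0 x = x := by rw [slide, zero_mul, add_zero]

/-- The cutoff in `slideAmount` is 1 for `|y| ≤ 3` and `|t| ≤ 1 / 4`, so at time 1 the slide there
is by the full `a`. If `|t| > 1 / 4`, the point is outside the tube radius whatever its `x`
coordinate becomes; if `|y| > 3`, neither set is met. -/
theorem slideIsotopy_mem_tubeVertical {a : ℝ} (ha : |a| ≤ 1) (q : Space) :
    q ∈ tubeVertical 0 ↔ (slideIsotopy a ha (1, q)).2 ∈ tubeVertical a := by
  obtain ⟨⟨x, y⟩, t⟩ := q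
  rw [slideIsotopy_apply]
  simp only [tubeVertical, tubed, mem_ofPred_eq, sub_zero]
  rcases le_or_gt |y| 3 with hy | hy
  swap
  · simp [hy.ne', hy.not_ge]
  rcases le_or_gt |t| (1 / 4) with ht | ht
  · have : slideAmount a (1, ((x, y), t)) = a := by
      rw [slideAmount, max_min_min_eq zero_le_one le_rfl _ _ (Or.inl rfl)]
      · simp
      · change (1 : ℝ) ≤ 4 - |y|; linarith
      · change (1 : ℝ) ≤ (1 - |t|) * (4 / 3); linarith
    rw [this]
    rcases slide_sub_cases ha x with h | ⟨h1, h2⟩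
    · rw [h]
    · have e1 : 1 / 16 < (slide a x - a) ^ 2 + t ^ 2 := by nlinarith [sq_nonneg t]
      have e2 : 1 / 16 < x ^ 2 + t ^ 2 := by nlinarith [sq_nonneg t]
      simp only [e1.le, e2.le, e1.ne', e2.ne']
  · have h : 1 / 16 < t ^ 2 := by rw [← sq_abs]; nlinarith
    generalize slide _ _ = x'
    have e1 : 1 / 16 < (x' - a) ^ 2 + t ^ 2 := by nlinarith [sq_nonneg (x' - a)]
    have e2 : 1 / 16 < x ^ 2 + t ^ 2 := by nlinarith [sq_nonneg x]
    simp only [e1.le, e2.le, e1.ne', e2.ne']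

theorem slideIsotopy_of_notMem {a : ℝ} (ha : |a| ≤ 1) (s : unitInterval) {q : Space}
    (hq : q ∉ neckInterior) : slideIsotopy a ha (s, q) = (s, q) := by
  obtain ⟨⟨x, y⟩, t⟩ := q
  rw [slideIsotopy_apply]
  have : slide (slideAmount a (s, ((x, y), t))) x = x := by
    rcases le_or_gt 2 |x| with hx | hx
    · exact slide_of_two_le hx
    · have : slideAmount a (s, ((x, y), t)) = 0 := by
        rw [slideAmount, max_min_min_eq_zero, mul_zero, mul_zero]
        by_contra! hn
        exact hq ⟨hx, by linarith [hn.1], by linarith [hn.2]⟩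
      rw [this, slide_zero]
  simp only [this]

theorem isotopicRel_tubeVertical {e : OpenPartialHomeomorph Space Space} {C X X' : Set Space}
    {a : ℝ} (ha : |a| ≤ 1) (he : IsBallChart e neckBall)
    (hX : IsReplacement e neckBall (tubeVertical 0) C X)
    (hX' : IsReplacement e neckBall (tubeVertical a) C X') : IsotopicRel X X' := by
  refine hX.isotopicRel he hX' isCompact_neckBall isOpen_neckInterior neckInterior_subset
    (slideIsotopy a ha) (fun p => rfl) (fun x => ?_) (fun s x hx => slideIsotopy_of_notMem ha s hx)
    (fun q _ => slideIsotopy_mem_tubeVertical ha q)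
  have : slideAmount a (0, x) = 0 := by simp [slideAmount]
  rw [slideIsotopy_apply, this, slide_zero]

/-! ### Neck cutting from the four tube relation -/

theorem IsReplacement.restrict {e : OpenPartialHomeomorph Space Space}
    {K K' L P S C X : Set Space} (hX : IsReplacement e K P C X)
    (hC : IsReplacement e K S C C) (hK : K' ⊆ K) (hL : L ⊆ K')
    (hP : ∀ q, q ∉ L → (q ∈ P ↔ q ∈ S)) : IsReplacement e K' P C X := by
  have := hX.comp (f := OpenPartialHomeomorph.refl Space) hC hK (by simpa using hL) hP
    (P' := P) (fun q _ => Iff.rfl)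
  rwa [OpenPartialHomeomorph.refl_trans] at this

theorem isFlatAt_tubeVertical {a : ℝ} {q : Space}
    (h : IsFlatAt (tubeVertical 0) ((q.1.1 - a, q.1.2), q.2)) : IsFlatAt (tubeVertical a) q := by
  let f : Space ≃ₜ Space :=
    ((Homeomorph.subRight a).prodCongr (Homeomorph.refl ℝ)).prodCongr (Homeomorph.refl ℝ)
  have h' := IsFlatAt.preimage f (q := q) h
  convert h' using 1
  ext p
  simp [f, tubeVertical, tubed]

/-- A neck may be moved sideways by an isotopy. -/
theorem exists_isReplacement_tubeVertical {e : OpenPartialHomeomorph Space Space} {a : ℝ}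
    (ha : |a| ≤ 1) {C N : Cobordism O O'} (he : IsBallChart e neckBall)
    (hC : IsReplacement e neckBall sheets C.carrier C.carrier)
    (hN : IsReplacement e neckBall (tubeVertical 0) C.carrier N.carrier) :
    ∃ X : Cobordism O O', IsReplacement e neckBall (tubeVertical a) C.carrier X.carrier ∧
      IsotopicRel N.carrier X.carrier := by
  have hv : Continuous fun p : ℝ × ℝ => p.1 - a := by fun_prop
  have hsub := solidTube_vertical_subset_neckInterior ha
  obtain ⟨X, hX⟩ := exists_isReplacement C he hC isCompact_neckBall
    (isCompact_neckBall.of_isClosed_subset (isClosed_solidTube hv)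
      (hsub.trans neckInterior_subset)) isOpen_neckInterior hsub neckInterior_subset
    -- The tube at `x = a` is flat because it is a translate of the tube at `x = 0`, which is flat
    -- inside `N`.
    (isClosed_tubed hv) (fun q hq => mem_tubed_iff_mem_sheets hq) (fun q hq hqP => by
      refine isFlatAt_tubeVertical (hN.isFlatAt he isOpen_neckInterior neckInterior_subset
        (solidTube_vertical_subset_neckInterior (a := 0) (by simp) ?_) ?_)
      · simpa [solidTube] using hq
      · simpa [tubeVertical, tubed] using hqP)
  exact ⟨X, hX, isotopicRel_tubeVertical ha he hN hX⟩

theorem solidTube_lower_subset_fourInterior :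
    solidTube (fun x y => |x| - min (-y - 1) 1) ⊆ fourInterior := by
  intro q hq
  have : ((q.1.1, -q.1.2), q.2) ∈ fourInterior :=
    solidTube_upper_subset_fourInterior (by simpa [solidTube] using hq)
  simpa [fourInterior] using this

theorem IsBallChart.mono {e : OpenPartialHomeomorph Space Space} {K K' : Set Space}
    (he : IsBallChart e K) (h : K' ⊆ K) : IsBallChart e K' :=
  ⟨h.trans he.1, (image_mono h).trans he.2⟩

/-- In the smaller ball `fourBall`, `H₁` and `H₂` play `C₁₂` and `C₃₄`, and the neck slid to `x =
-1` and to `x = 1` plays `C₁₃` and `C₂₄`. The neck cutting relator is the negative of the resulting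
4Tu relator. -/
theorem neckCuttingRelators_subset (R : Type*) [CommRing R] :
    neckCuttingRelators R O O' ⊆ Submodule.span R (fourTubeRelators R O O') := by
  rintro _ ⟨e, C, N, H₁, H₂, he, hC, hN, hH₁, hH₂, rfl⟩
  obtain ⟨X, hX, hNX⟩ := exists_isReplacement_tubeVertical (a := -1) (by simp) he hC hN
  obtain ⟨Y, hY, hNY⟩ := exists_isReplacement_tubeVertical (a := 1) (by simp) he hC hN
  have hX' : cls R N = cls R X := by
    unfold cls; rw [show (Quotient.mk _ N : Mor O O') = Quotient.mk _ X from Quotient.sound hNX]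
  have hY' : cls R N = cls R Y := by
    unfold cls; rw [show (Quotient.mk _ N : Mor O O') = Quotient.mk _ Y from Quotient.sound hNY]
  have hsub := fourBall_subset_neckBall
  have : (cls R H₁ + cls R H₂) - (cls R X + cls R Y) ∈
      Submodule.span R (fourTubeRelators R O O') := by
    refine Submodule.subset_span ⟨e, C, H₁, H₂, X, Y, he.mono hsub,
      hC.restrict hC hsub (empty_subset _) (fun q _ => Iff.rfl),
      hH₁.restrict hC hsub ?_ (fun q => mem_tubed_iff_mem_sheets),
      hH₂.restrict hC hsub ?_ (fun q => mem_tubed_iff_mem_sheets),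
      hX.restrict hC hsub ?_ (fun q => mem_tubed_iff_mem_sheets),
      hY.restrict hC hsub ?_ (fun q => mem_tubed_iff_mem_sheets), rfl⟩
    · exact solidTube_upper_subset_fourInterior.trans fourInterior_subset
    · exact solidTube_lower_subset_fourInterior.trans fourInterior_subset
    · exact (solidTube_vertical_subset_fourInterior (by simp)).trans fourInterior_subset
    · exact (solidTube_vertical_subset_fourInterior (by simp)).trans fourInterior_subset
  have h := neg_mem this
  rw [← hX', ← hY'] at h
  rwa [neg_sub, ← two_smul R] at h

/-! ### Squeezing the neck ball and making a small handle -/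

/-- The odd piecewise linear function with slope `a` on `[-m, m]` and slope `b` elsewhere. -/
noncomputable def stretch (m a b x : ℝ) : ℝ :=
  a * max (-m) (min x m) + b * (x - max (-m) (min x m))

section stretch

variable {m a b x : ℝ}

theorem stretch_of_le (hm : 0 < m) (h : m ≤ x) : stretch m a b x = a * m + b * (x - m) := by
  rw [stretch, min_eq_right h, max_eq_right (by linarith)]

theorem stretch_of_le_neg (hm : 0 < m) (h : x ≤ -m) :
    stretch m a b x = -(a * m) + b * (x + m) := by
  rw [stretch, min_eq_left (by linarith), max_eq_left h]
  ring

theorem stretch_of_abs_le (h : |x| ≤ m) : stretch m a b x = a * x := by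
  obtain ⟨h1, h2⟩ := abs_le.1 h
  rw [stretch, min_eq_left h2, max_eq_right h1]
  ring

theorem stretch_stretch (hm : 0 < m) (ha : 0 < a) (hb : 0 < b) (x : ℝ) :
    stretch (a * m) a⁻¹ b⁻¹ (stretch m a b x) = x := by
  have ham := mul_pos ha hm
  rcases le_total m x with h | h
  · have := mul_nonneg hb.le (sub_nonneg.2 h)
    rw [stretch_of_le hm h, stretch_of_le ham (by linarith)]
    field_simp
    ring
  rcases le_total x (-m) with h' | h'
  · have := mul_nonneg hb.le (by linarith : 0 ≤ -(x + m))
    rw [stretch_of_le_neg hm h', stretch_of_le_neg ham (by linarith)]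
    field_simp
    ring
  · rw [stretch_of_abs_le (abs_le.2 ⟨h', h⟩), stretch_of_abs_le]
    · field_simp
    · rw [abs_mul, abs_of_pos ha]
      exact mul_le_mul_of_nonneg_left (abs_le.2 ⟨h', h⟩) ha.le

theorem stretch_neg (hm : 0 < m) (x : ℝ) : stretch m a b (-x) = -stretch m a b x := by
  rcases le_total m x with h | h
  · rw [stretch_of_le hm h, stretch_of_le_neg hm (by linarith)]
    ring
  rcases le_total x (-m) with h' | h'
  · rw [stretch_of_le_neg hm h', stretch_of_le hm (by linarith)]
    ring
  · have := abs_le.2 ⟨h', h⟩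
    rw [stretch_of_abs_le this, stretch_of_abs_le (by rwa [abs_neg])]
    ring

theorem strictMono_stretch (ha : 0 < a) (hb : 0 < b) : StrictMono (stretch m a b) := by
  intro x y hxy
  have h1 : max (-m) (min x m) ≤ max (-m) (min y m) := by gcongr
  have h2 : max (-m) (min y m) - max (-m) (min x m) ≤ y - x := by
    have := abs_max_sub_max_le_abs (min y m) (min x m) (-m)
    have h3 := abs_min_sub_min_le_max y m x m
    rw [sub_self, abs_zero, max_eq_left (abs_nonneg _), abs_of_pos (sub_pos.2 hxy)] at h3
    rw [max_comm (-m), max_comm (-m)]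
    exact (le_abs_self _).trans (this.trans h3)
  simp only [stretch]
  rcases h1.eq_or_lt with h | h
  · rw [h]; nlinarith
  · nlinarith

theorem abs_stretch (hm : 0 < m) (ha : 0 < a) (hb : 0 < b) (x : ℝ) :
    |stretch m a b x| = stretch m a b |x| := by
  have h0 : stretch m a b 0 = 0 := by rw [stretch_of_abs_le (by simpa using hm.le), mul_zero]
  rcases le_total 0 x with h | h
  · rw [abs_of_nonneg h, abs_of_nonneg]
    rw [← h0]
    exact (strictMono_stretch ha hb).monotone h
  · rw [abs_of_nonpos h, stretch_neg hm, abs_of_nonpos]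
    rw [← h0]
    exact (strictMono_stretch ha hb).monotone h

end stretch

/-- The homeomorphism of the line given by `stretch`. -/
noncomputable def stretchHomeo (m a b : ℝ) (hm : 0 < m) (ha : 0 < a) (hb : 0 < b) : ℝ ≃ₜ ℝ where
  toFun := stretch m a b
  invFun := stretch (a * m) a⁻¹ b⁻¹
  left_inv := stretch_stretch hm ha hb
  right_inv x := by
    have := stretch_stretch (mul_pos ha hm) (inv_pos.2 ha) (inv_pos.2 hb) x
    rwa [inv_mul_cancel_left₀ ha.ne', inv_inv, inv_inv] at this
  continuous_toFun := by unfold stretch; fun_prop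
  continuous_invFun := by unfold stretch; fun_prop

/-- A homeomorphism that squeezes `neckBall` into a neighbourhood of the left side of
`fourBall`. -/
noncomputable def squeeze : Space ≃ₜ Space :=
  -- In `x` the tube radius 1/4 is kept and 2 goes to 3/8. The reversed sign is invisible to the
  -- squared equation of the vertical tube. In `y` the planes at 3 are fixed, 4 goes to 16/5, and
  -- 1/2 goes to 5/2, which pushes `tubeUpper` close to the upper plane.
  (((stretchHomeo (1 / 4) 1 (1 / 14) (by norm_num) (by norm_num) (by norm_num)).trans
    (Homeomorph.subLeft (-1))).prodCongr
    (stretchHomeo (1 / 2) 5 (1 / 5) (by norm_num) (by norm_num) (by norm_num))).prodCongr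
    (Homeomorph.refl ℝ)

theorem squeeze_apply (q : Space) : squeeze q =
    ((-1 - stretch (1 / 4) 1 (1 / 14) q.1.1, stretch (1 / 2) 5 (1 / 5) q.1.2), q.2) := rfl

/-- The image of `neckBall` under `squeeze`. -/
def leftBall : Set Space := {p | |p.1.1 + 1| ≤ 3 / 8 ∧ |p.1.2| ≤ 16 / 5 ∧ |p.2| ≤ 1}

theorem abs_stretch_fst_le (x : ℝ) : |stretch (1 / 4) 1 (1 / 14) x| ≤ 3 / 8 ↔ |x| ≤ 2 := by
  rw [abs_stretch (by norm_num) (by norm_num) (by norm_num),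
    ← (strictMono_stretch (m := 1 / 4) (a := 1) (b := 1 / 14) (by norm_num)
      (by norm_num)).le_iff_le (b := 2),
    stretch_of_le (x := 2) (by norm_num) (by norm_num)]
  norm_num

theorem abs_stretch_snd_le (y : ℝ) : |stretch (1 / 2) 5 (1 / 5) y| ≤ 16 / 5 ↔ |y| ≤ 4 := by
  rw [abs_stretch (by norm_num) (by norm_num) (by norm_num),
    ← (strictMono_stretch (m := 1 / 2) (a := 5) (b := 1 / 5) (by norm_num)
      (by norm_num)).le_iff_le (b := 4),
    stretch_of_le (x := 4) (by norm_num) (by norm_num)]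
  norm_num

theorem stretch_snd_three : stretch (1 / 2) 5 (1 / 5) 3 = 3 := by
  rw [stretch_of_le (by norm_num) (by norm_num)]
  norm_num

theorem abs_stretch_snd_le_three (y : ℝ) : |stretch (1 / 2) 5 (1 / 5) y| ≤ 3 ↔ |y| ≤ 3 := by
  rw [abs_stretch (by norm_num) (by norm_num) (by norm_num)]
  conv_lhs => rw [← stretch_snd_three]
  exact (strictMono_stretch (by norm_num) (by norm_num)).le_iff_le

theorem abs_stretch_snd_eq_three (y : ℝ) : |stretch (1 / 2) 5 (1 / 5) y| = 3 ↔ |y| = 3 := by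
  rw [abs_stretch (by norm_num) (by norm_num) (by norm_num)]
  conv_lhs => rw [← stretch_snd_three]
  exact (strictMono_stretch (by norm_num) (by norm_num)).injective.eq_iff

theorem stretch_fst_cases (x : ℝ) : stretch (1 / 4) 1 (1 / 14) x = x ∨
    1 / 16 < stretch (1 / 4) 1 (1 / 14) x ^ 2 ∧ 1 / 16 < x ^ 2 := by
  rcases le_or_gt |x| (1 / 4) with h | h
  · left
    rw [stretch_of_abs_le h, one_mul]
  · right
    have := (strictMono_stretch (m := 1 / 4) (a := 1) (b := 1 / 14) (by norm_num) (by norm_num)) h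
    rw [stretch_of_le (x := 1 / 4) (by norm_num) le_rfl,
      ← abs_stretch (by norm_num) (by norm_num) (by norm_num)] at this
    rw [← sq_abs x, ← sq_abs (stretch _ _ _ _)]
    constructor <;> nlinarith

theorem squeeze_mem_leftBall {q : Space} : squeeze q ∈ leftBall ↔ q ∈ neckBall := by
  simp only [squeeze_apply, leftBall, neckBall, mem_ofPred_eq]
  rw [abs_stretch_snd_le, ← abs_stretch_fst_le, ← abs_neg]
  ring_nf

theorem leftBall_subset_image : leftBall ⊆ squeeze '' neckBall := fun p hp =>
  ⟨squeeze.symm p, squeeze_mem_leftBall.1 (by simpa using hp), by simp⟩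

theorem squeeze_mem_sheets {q : Space} : squeeze q ∈ sheets ↔ q ∈ sheets :=
  abs_stretch_snd_eq_three q.1.2

theorem squeeze_mem_tubeVertical {q : Space} :
    squeeze q ∈ tubeVertical (-1) ↔ q ∈ tubeVertical 0 := by
  simp only [squeeze_apply, tubeVertical, tubed, mem_ofPred_eq, abs_stretch_snd_le_three,
    abs_stretch_snd_eq_three, sub_zero]
  rw [show -1 - stretch (1 / 4) 1 (1 / 14) q.1.1 - -1 = -stretch (1 / 4) 1 (1 / 14) q.1.1 by ring,
    neg_sq]
  rcases stretch_fst_cases q.1.1 with h | ⟨h1, h2⟩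
  · rw [h]
  · have e1 : 1 / 16 < stretch (1 / 4) 1 (1 / 14) q.1.1 ^ 2 + q.2 ^ 2 := by
      nlinarith [sq_nonneg q.2]
    have e2 : 1 / 16 < q.1.1 ^ 2 + q.2 ^ 2 := by nlinarith [sq_nonneg q.2]
    simp only [e1.le, e2.le, e1.ne', e2.ne']

/-- The two planes with a small handle added to the upper plane near `x = -1`. -/
def handle : Set Space := squeeze.symm ⁻¹' tubeUpper

/-- The region where `handle` differs from the two planes. -/
def handleRegion : Set Space :=
  squeeze.symm ⁻¹' solidTube (fun x y => |x| - min (y - 1) 1)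

theorem squeeze_mem_handle {q : Space} : squeeze q ∈ handle ↔ q ∈ tubeUpper := by
  simp [handle]

theorem mem_handle_iff_mem_sheets {q : Space} (hq : q ∉ handleRegion) :
    q ∈ handle ↔ q ∈ sheets := by
  have : squeeze.symm q ∈ tubeUpper ↔ _ := mem_tubed_iff_mem_sheets hq
  rw [← squeeze_mem_sheets, squeeze.apply_symm_apply] at this
  exact this

theorem isClosed_handle : IsClosed handle :=
  (isClosed_tubed continuous_upper).preimage squeeze.symm.continuous

theorem isClosed_handleRegion : IsClosed handleRegion :=
  (isClosed_solidTube continuous_upper).preimage squeeze.symm.continuous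

/-- The bound `5 / 2 ≤ y` is the one that matters: it places the handle in `y ≥ 2`, where `bendFun`
is the identity. -/
theorem bounds_of_mem_handleRegion {p : Space} (hp : p ∈ handleRegion) :
    |p.1.1 + 1| ≤ 3 / 8 ∧ 5 / 2 ≤ p.1.2 ∧ p.1.2 ≤ 3 ∧ |p.2| ≤ 1 / 4 := by
  obtain ⟨q, rfl⟩ := squeeze.surjective p
  simp only [handleRegion, mem_preimage, Homeomorph.symm_apply_apply] at hp
  have hq := solidTube_upper_subset_fourInterior hp
  obtain ⟨h1, h2, h3⟩ := abs_le_of_mem_solidTube hp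
  have hb := squeeze_mem_leftBall.2 (neckInterior_subset ⟨hq.1, hq.2.1, hq.2.2.2⟩)
  refine ⟨hb.1, ?_, (abs_le.1 ((abs_stretch_snd_le_three q.1.2).2 h1)).2, h3⟩
  -- On the solid upper tube even `y ≥ 3 / 4` holds; 1/2 is the breakpoint of the vertical stretch,
  -- whose image is 5/2.
  have hy : 1 / 2 ≤ q.1.2 := by
    have := abs_nonneg q.1.1
    rw [abs_le] at h2
    rcases min_cases (q.1.2 - 1) 1 with ⟨h, h'⟩ | ⟨h, h'⟩ <;> rw [h] at h2 <;> linarith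
  have := (strictMono_stretch (m := 1 / 2) (a := 5) (b := 1 / 5) (by norm_num)
    (by norm_num)).monotone hy
  rw [stretch_of_le (x := 1 / 2) (by norm_num) le_rfl] at this
  rw [squeeze_apply]
  change 5 / 2 ≤ stretch (1 / 2) 5 (1 / 5) q.1.2
  linarith

theorem handleRegion_subset_leftBall : handleRegion ⊆ leftBall := fun p hp => by
  obtain ⟨h1, h2, h3, h4⟩ := bounds_of_mem_handleRegion hp
  exact ⟨h1, abs_le.2 ⟨by linarith, by linarith⟩, by linarith⟩

theorem leftBall_subset_fourBall : leftBall ⊆ fourBall := fun p ⟨h1, h2, h3⟩ => by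
  obtain ⟨h4, h5⟩ := abs_le.1 h1
  have : |p.1.1| = -p.1.1 := abs_of_neg (by linarith)
  refine ⟨?_, by linarith, ?_, h3⟩ <;> rw [this] <;> linarith

theorem handleRegion_subset_fourInterior : handleRegion ⊆ fourInterior := fun p hp => by
  obtain ⟨h1, h2, h3, h4⟩ := bounds_of_mem_handleRegion hp
  obtain ⟨h5, h6⟩ := abs_le.1 h1
  have e1 : |p.1.1| = -p.1.1 := abs_of_neg (by linarith)
  have e2 : |p.1.2| = p.1.2 := abs_of_pos (by linarith)
  refine ⟨?_, ?_, ?_, by linarith⟩ <;> simp only [e1, e2] <;> linarith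

/-- A handle may be added to the disk `D₁` if a tube may be attached to it. -/
theorem exists_isReplacement_handle {e : OpenPartialHomeomorph Space Space}
    {C T : Cobordism O O'} (he : IsBallChart e fourBall)
    (hC : IsReplacement e fourBall sheets C.carrier C.carrier)
    (hT : IsReplacement e fourBall tubeUpper C.carrier T.carrier) :
    ∃ X : Cobordism O O', IsReplacement e fourBall handle C.carrier X.carrier := by
  refine exists_isReplacement C he hC isCompact_fourBall
    (isCompact_fourBall.of_isClosed_subset isClosed_handleRegion
      (handleRegion_subset_fourInterior.trans fourInterior_subset)) isOpen_fourInterior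
    handleRegion_subset_fourInterior fourInterior_subset isClosed_handle
    (fun q => mem_handle_iff_mem_sheets) (fun q hq hqP => ?_)
  -- The handle is a homeomorphic copy of `tubeUpper`, so it inherits the flatness of the tube in
  -- `T`.
  exact IsFlatAt.preimage squeeze.symm (hT.isFlatAt he isOpen_fourInterior fourInterior_subset
    (solidTube_upper_subset_fourInterior hq) hqP)

/-! ### Reflection symmetries -/

/-- The reflection in the plane `x = 0`. -/
def reflectX : Space ≃ₜ Space :=
  ((Homeomorph.neg ℝ).prodCongr (Homeomorph.refl ℝ)).prodCongr (Homeomorph.refl ℝ)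

/-- The reflection in the plane `y = 0`. -/
def reflectY : Space ≃ₜ Space :=
  ((Homeomorph.refl ℝ).prodCongr (Homeomorph.neg ℝ)).prodCongr (Homeomorph.refl ℝ)

theorem reflectX_apply (q : Space) : reflectX q = ((-q.1.1, q.1.2), q.2) := rfl

theorem reflectY_apply (q : Space) : reflectY q = ((q.1.1, -q.1.2), q.2) := rfl

theorem reflectX_reflectX (q : Space) : reflectX (reflectX q) = q := by
  simp [reflectX_apply]

theorem reflectY_reflectY (q : Space) : reflectY (reflectY q) = q := by
  simp [reflectY_apply]

theorem reflectX_mem_fourBall (q : Space) : reflectX q ∈ fourBall ↔ q ∈ fourBall := by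
  simp [fourBall, reflectX_apply]

theorem reflectY_mem_fourBall (q : Space) : reflectY q ∈ fourBall ↔ q ∈ fourBall := by
  simp [fourBall, reflectY_apply]

theorem reflectY_mem_leftBall (q : Space) : reflectY q ∈ leftBall ↔ q ∈ leftBall := by
  simp [leftBall, reflectY_apply]

theorem reflectX_mem_sheets (q : Space) : reflectX q ∈ sheets ↔ q ∈ sheets := by
  simp [sheets, reflectX_apply]

theorem reflectY_mem_sheets (q : Space) : reflectY q ∈ sheets ↔ q ∈ sheets := by
  simp [sheets, reflectY_apply]

theorem reflectY_mem_tubeUpper (q : Space) : reflectY q ∈ tubeUpper ↔ q ∈ tubeLower := by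
  simp [tubeUpper, tubeLower, tubed, reflectY_apply]

theorem reflectY_mem_tubeLower (q : Space) : reflectY q ∈ tubeLower ↔ q ∈ tubeUpper := by
  rw [← reflectY_mem_tubeUpper, reflectY_reflectY]

theorem reflectX_mem_tubeVertical (a : ℝ) (q : Space) :
    reflectX q ∈ tubeVertical a ↔ q ∈ tubeVertical (-a) := by
  have : (-q.1.1 - a) ^ 2 = (q.1.1 - -a) ^ 2 := by ring
  simp [tubeVertical, tubed, reflectX_apply, this]

theorem squeeze_reflectY (q : Space) : squeeze (reflectY q) = reflectY (squeeze q) := by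
  simp only [squeeze_apply, reflectY_apply, stretch_neg (by norm_num : (0 : ℝ) < 1 / 2)]

theorem IsBallChart.reflect {e : OpenPartialHomeomorph Space Space} {K : Set Space}
    (he : IsBallChart e K) (r : Space ≃ₜ Space) (hr : ∀ q, r q ∈ K ↔ q ∈ K) :
    IsBallChart (r.transOpenPartialHomeomorph e) K := by
  refine ⟨fun q hq => he.1 ((hr q).2 hq), ?_⟩
  rintro _ ⟨q, hq, rfl⟩
  exact he.2 ⟨r q, (hr q).2 hq, rfl⟩

theorem IsReplacement.reflect {e : OpenPartialHomeomorph Space Space} {K P P' C X : Set Space}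
    (h : IsReplacement e K P C X) (r : Space ≃ₜ Space) (hr : ∀ q, r q ∈ K ↔ q ∈ K)
    (hP : ∀ q, r q ∈ P ↔ q ∈ P') :
    IsReplacement (r.transOpenPartialHomeomorph e) K P' C X := by
  refine ⟨fun q hq => (h.1 (r q) ((hr q).2 hq)).trans (hP q), fun x hx => h.2 x ?_⟩
  rintro ⟨q, hq, rfl⟩
  refine hx ⟨r.symm q, (hr _).1 (by simpa using hq), ?_⟩
  change e (r (r.symm q)) = e q
  rw [r.apply_symm_apply]

/-! ### Neck cutting for a vertical tube -/

/-- The neck cutting relation for the left side of the model ball `fourBall`. -/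
theorem relator_mem_of_leftBall (R : Type*) [CommRing R]
    {e : OpenPartialHomeomorph Space Space} {C N X Y : Cobordism O O'}
    (he : IsBallChart e leftBall) (hC : IsReplacement e leftBall sheets C.carrier C.carrier)
    (hN : IsReplacement e leftBall (tubeVertical (-1)) C.carrier N.carrier)
    (hX : IsReplacement e leftBall handle C.carrier X.carrier)
    (hY : IsReplacement e leftBall (reflectY ⁻¹' handle) C.carrier Y.carrier) :
    (2 : R) • cls R N - (cls R X + cls R Y) ∈ neckCuttingRelators R O O' := by
  have hmaps : MapsTo squeeze.toOpenPartialHomeomorph neckBall leftBall := fun q =>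
    squeeze_mem_leftBall.2
  have himg : leftBall ⊆ squeeze.toOpenPartialHomeomorph '' neckBall := leftBall_subset_image
  refine ⟨squeeze.toOpenPartialHomeomorph.trans e, C, N, X, Y,
    he.comp (subset_univ _) hmaps,
    hC.comp hC hmaps (empty_subset _) (fun q _ => Iff.rfl) (fun q _ => squeeze_mem_sheets),
    hN.comp hC hmaps (L := solidTube fun x _ => x - -1) (fun p hp => himg ?_)
      (fun q => mem_tubed_iff_mem_sheets) (fun q _ => squeeze_mem_tubeVertical),
    hX.comp hC hmaps (handleRegion_subset_leftBall.trans himg)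
      (fun q => mem_handle_iff_mem_sheets) (fun q _ => squeeze_mem_handle),
    hY.comp hC hmaps (L := reflectY ⁻¹' handleRegion) (fun p hp => himg ?_)
      (fun q hq => (mem_handle_iff_mem_sheets hq).trans (reflectY_mem_sheets q))
      (fun q _ => ?_), rfl⟩
  · obtain ⟨h1, h2, h3⟩ := abs_le_of_mem_solidTube hp
    rw [sub_neg_eq_add] at h2
    exact ⟨by linarith, by linarith, by linarith⟩
  · exact (reflectY_mem_leftBall p).1 (handleRegion_subset_leftBall hp)
  · change reflectY (squeeze q) ∈ handle ↔ _
    rw [← squeeze_reflectY, squeeze_mem_handle, reflectY_mem_tubeUpper]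

theorem vertical_relator_mem (R : Type*) [CommRing R]
    {e : OpenPartialHomeomorph Space Space} {C N X Y : Cobordism O O'}
    (he : IsBallChart e fourBall) (hC : IsReplacement e fourBall sheets C.carrier C.carrier)
    (hN : IsReplacement e fourBall (tubeVertical (-1)) C.carrier N.carrier)
    (hX : IsReplacement e fourBall handle C.carrier X.carrier)
    (hY : IsReplacement e fourBall (reflectY ⁻¹' handle) C.carrier Y.carrier) :
    (2 : R) • cls R N - (cls R X + cls R Y) ∈ neckCuttingRelators R O O' := by
  have hsub := leftBall_subset_fourBall
  refine relator_mem_of_leftBall R (he.mono hsub)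
    (hC.restrict hC hsub (empty_subset _) fun q _ => Iff.rfl)
    (hN.restrict hC hsub (L := solidTube fun x _ => x - -1) (fun p hp => ?_)
      (fun q => mem_tubed_iff_mem_sheets))
    (hX.restrict hC hsub handleRegion_subset_leftBall fun q => mem_handle_iff_mem_sheets)
    (hY.restrict hC hsub (L := reflectY ⁻¹' handleRegion)
      (fun p hp => (reflectY_mem_leftBall p).1 (handleRegion_subset_leftBall hp))
      (fun q hq => (mem_handle_iff_mem_sheets hq).trans (reflectY_mem_sheets q)))
  obtain ⟨h1, h2, h3⟩ := abs_le_of_mem_solidTube hp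
  rw [sub_neg_eq_add] at h2
  exact ⟨by linarith, by linarith, by linarith⟩

/-! ### Bending the vertical tube into the upper tube -/

/-- A map that bends the vertical strip around `x = -1` into a strip around `y = 1 + |x|`. -/
noncomputable def bendFun (p : Space) : Space :=
  -- For `y ≥ 2` this is the identity and for `y ≤ -2` the half turn about the `t`-axis. In between,
  -- the line `x = c` with `c < 0` goes onto part of the curve `y = 2 + c + |x|`, which for `c = -1`
  -- is the core of `tubeUpper`.
  ((p.1.1 * max (-1) (min (p.1.2 / 2) 1),
    2 + p.1.1 - p.1.1 * |max (-1) (min (p.1.2 / 2) 1)| + max (|p.1.2| - 2) 0), p.2)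

/-- The inverse of `bendFun`. -/
noncomputable def unbendFun (p : Space) : Space :=
  ((-1 - (|p.1.1| - min (p.1.2 - 1) 1),
    -2 * p.1.1 / (1 + (|p.1.1| - min (p.1.2 - 1) 1)) -
      max (-1) (min (2 * p.1.1) 1) * max (p.1.2 - 2) 0), p.2)

theorem bendFun_of_two_le {x y t : ℝ} (h : 2 ≤ y) : bendFun ((x, y), t) = ((x, y), t) := by
  have e1 : max (-1) (min (y / 2) 1) = 1 := by
    rw [min_eq_right (by linarith), max_eq_right (by norm_num)]
  have e2 : max (|y| - 2) 0 = y - 2 := by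
    rw [abs_of_nonneg (by linarith), max_eq_left (by linarith)]
  simp only [bendFun, e1, e2, Prod.mk.injEq, abs_one, and_true]
  constructor <;> ring

theorem bendFun_of_le_neg_two {x y t : ℝ} (h : y ≤ -2) :
    bendFun ((x, y), t) = ((-x, -y), t) := by
  have e1 : max (-1) (min (y / 2) 1) = -1 := by
    rw [min_eq_left (by linarith), max_eq_left (by linarith)]
  have e2 : max (|y| - 2) 0 = -y - 2 := by
    rw [abs_of_nonpos (by linarith), max_eq_left (by linarith)]
  simp only [bendFun, e1, e2, Prod.mk.injEq, abs_neg, abs_one, and_true]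
  constructor <;> ring

theorem bendFun_of_abs_le {x y t : ℝ} (h : |y| ≤ 2) :
    bendFun ((x, y), t) = ((x * y / 2, 2 + x - x * |y| / 2), t) := by
  obtain ⟨h1, h2⟩ := abs_le.1 h
  have e1 : max (-1) (min (y / 2) 1) = y / 2 := by
    rw [min_eq_left (by linarith), max_eq_right (by linarith)]
  have e2 : max (|y| - 2) 0 = 0 := max_eq_right (by linarith)
  simp only [bendFun, e1, e2, Prod.mk.injEq, abs_div, abs_two, and_true]
  constructor <;> ring

theorem unbendFun_of_two_le_of_neg {x y t : ℝ} (h : 2 ≤ y) (hx : x ≤ -1 / 2) :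
    unbendFun ((x, y), t) = ((x, y), t) := by
  have e1 : max (-1) (min (2 * x) 1) = -1 := by
    rw [min_eq_left (by linarith), max_eq_left (by linarith)]
  have e2 : max (y - 2) 0 = y - 2 := max_eq_left (by linarith)
  have e3 : min (y - 1) 1 = 1 := min_eq_right (by linarith)
  have e4 : -2 * x / (1 + (-x - 1)) = 2 := by
    rw [show 1 + (-x - 1) = -x by ring, div_eq_iff (by linarith)]
    ring
  simp only [unbendFun, e1, e2, e3, abs_of_neg (by linarith : x < 0), e4, Prod.mk.injEq, and_true]
  constructor <;> ring

theorem unbendFun_of_two_le_of_pos {x y t : ℝ} (h : 2 ≤ y) (hx : 1 / 2 ≤ x) :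
    unbendFun ((x, y), t) = ((-x, -y), t) := by
  have e1 : max (-1) (min (2 * x) 1) = 1 := by
    rw [min_eq_right (by linarith), max_eq_right (by linarith)]
  have e2 : max (y - 2) 0 = y - 2 := max_eq_left (by linarith)
  have e3 : min (y - 1) 1 = 1 := min_eq_right (by linarith)
  have e4 : -2 * x / (1 + (x - 1)) = -2 := by
    rw [show 1 + (x - 1) = x by ring, div_eq_iff (by linarith)]
  simp only [unbendFun, e1, e2, e3, abs_of_pos (by linarith : 0 < x), e4, Prod.mk.injEq, and_true]
  constructor <;> ring

theorem unbendFun_of_le_two {x y t : ℝ} (h : y ≤ 2) :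
    unbendFun ((x, y), t) = ((y - 2 - |x|, -2 * x / (2 + |x| - y)), t) := by
  have e2 : max (y - 2) 0 = 0 := max_eq_right (by linarith)
  have e3 : min (y - 1) 1 = y - 1 := min_eq_left (by linarith)
  simp only [unbendFun, e2, e3, Prod.mk.injEq, and_true, mul_zero, sub_zero]
  exact ⟨by ring, by congr 1; ring⟩

/-- In the bent strip, the function that defines `tubeUpper` is a coordinate. -/
theorem upper_bendFun {x y t : ℝ} (hx : x < 0) :
    |(bendFun ((x, y), t)).1.1| - min ((bendFun ((x, y), t)).1.2 - 1) 1 = -1 - x := by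
  rcases le_total 2 y with h | h
  · rw [bendFun_of_two_le h]
    simp only
    rw [min_eq_right (by linarith), abs_of_neg hx]
    ring
  rcases le_total y (-2) with h' | h'
  · rw [bendFun_of_le_neg_two h']
    simp only
    rw [min_eq_right (by linarith), abs_of_pos (by linarith)]
    ring
  · have hy := abs_le.2 ⟨h', h⟩
    rw [bendFun_of_abs_le hy]
    simp only
    rw [min_eq_left (by nlinarith), abs_div, abs_mul, abs_of_neg hx, abs_two]
    ring

theorem unbendFun_bendFun {p : Space} (hp : |p.1.1 + 1| < 1 / 2) :
    unbendFun (bendFun p) = p := by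
  obtain ⟨⟨x, y⟩, t⟩ := p
  obtain ⟨h1, h2⟩ := abs_lt.1 hp
  simp only at h1 h2
  rcases le_total 2 y with h | h
  · rw [bendFun_of_two_le h, unbendFun_of_two_le_of_neg h (by linarith)]
  rcases le_total y (-2) with h' | h'
  · rw [bendFun_of_le_neg_two h', unbendFun_of_two_le_of_pos (by linarith) (by linarith), neg_neg,
      neg_neg]
  · have hy := abs_le.2 ⟨h', h⟩
    rw [bendFun_of_abs_le hy, unbendFun_of_le_two (by nlinarith), abs_div, abs_mul,
      abs_of_neg (by linarith : x < 0), abs_two]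
    simp only [Prod.mk.injEq, and_true]
    refine ⟨by ring, ?_⟩
    rw [show 2 + -x * |y| / 2 - (2 + x - x * |y| / 2) = -x by ring, div_eq_iff (by linarith)]
    ring

theorem bendFun_unbendFun {p : Space} (hp : |(|p.1.1| - min (p.1.2 - 1) 1)| < 1 / 2) :
    bendFun (unbendFun p) = p := by
  obtain ⟨⟨x, y⟩, t⟩ := p
  obtain ⟨h1, h2⟩ := abs_lt.1 hp
  simp only at h1 h2
  rcases le_total 2 y with h | h
  · rw [min_eq_right (by linarith)] at h1 h2
    rcases le_total 0 x with hx | hx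
    · rw [abs_of_nonneg hx] at h1 h2
      rw [unbendFun_of_two_le_of_pos h (by linarith), bendFun_of_le_neg_two (by linarith), neg_neg,
        neg_neg]
    · rw [abs_of_nonpos hx] at h1 h2
      rw [unbendFun_of_two_le_of_neg h (by linarith), bendFun_of_two_le h]
  · rw [min_eq_left (by linarith)] at h1 h2
    have hpos : 0 < 2 + |x| - y := by linarith
    have habs : |-2 * x / (2 + |x| - y)| = 2 * |x| / (2 + |x| - y) := by
      rw [abs_div, abs_mul, abs_of_pos hpos, abs_neg, abs_two]
    rw [unbendFun_of_le_two h, bendFun_of_abs_le, habs]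
    · simp only [Prod.mk.injEq, and_true]
      constructor
      · field_simp
        ring
      · field_simp
        ring
    · rw [habs, div_le_iff₀ hpos]
      linarith

/-- The bending map, as a homeomorphism between two strips. -/
noncomputable def bend : OpenPartialHomeomorph Space Space where
  toFun := bendFun
  invFun := unbendFun
  source := {p | |p.1.1 + 1| < 1 / 2}
  target := {p | |(|p.1.1| - min (p.1.2 - 1) 1)| < 1 / 2}
  map_source' := by
    rintro ⟨⟨x, y⟩, t⟩ hp
    have hp' : |x + 1| < 1 / 2 := hp
    rw [mem_ofPred_eq, upper_bendFun (by linarith [(abs_lt.1 hp').2]), ← abs_neg]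
    ring_nf at hp' ⊢
    exact hp'
  map_target' := by
    rintro p hp
    simp only [mem_ofPred_eq, unbendFun] at hp ⊢
    rw [← abs_neg]
    ring_nf at hp ⊢
    exact hp
  left_inv' := fun _ => unbendFun_bendFun
  right_inv' := fun _ => bendFun_unbendFun
  open_source := isOpen_lt (by fun_prop) (by fun_prop)
  open_target := isOpen_lt (by fun_prop) (by fun_prop)
  continuousOn_toFun := by
    unfold bendFun
    fun_prop
  continuousOn_invFun := by
    -- On the target strip the denominator is more than 1/2.
    have : ∀ p ∈ {p : Space | |(|p.1.1| - min (p.1.2 - 1) 1)| < 1 / 2},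
        1 + (|p.1.1| - min (p.1.2 - 1) 1) ≠ 0 := fun p hp => by
      have hp' : |(|p.1.1| - min (p.1.2 - 1) 1)| < 1 / 2 := hp
      linarith [(abs_lt.1 hp').1]
    unfold unbendFun
    fun_prop (disch := assumption)

/-- The lower half of the strip becomes its right half, so the handle on the lower disk is carried
to the handle on `D₂`. -/
theorem bendFun_reflectY (q : Space) : bendFun (reflectY q) = reflectX (bendFun q) := by
  obtain ⟨⟨x, y⟩, t⟩ := q
  rw [reflectY_apply, reflectX_apply]
  simp only
  rcases le_total 2 y with h | h
  · rw [bendFun_of_two_le h, bendFun_of_le_neg_two (by linarith), neg_neg]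
  rcases le_total y (-2) with h' | h'
  · rw [bendFun_of_le_neg_two h', bendFun_of_two_le (by linarith), neg_neg]
  · have hy := abs_le.2 ⟨h', h⟩
    rw [bendFun_of_abs_le hy, bendFun_of_abs_le (by rwa [abs_neg]), abs_neg]
    simp only [Prod.mk.injEq, and_true]
    ring

theorem neg_of_mem_leftBall {q : Space} (hq : q ∈ leftBall) : q.1.1 ≤ -5 / 8 := by
  have := (abs_le.1 hq.1).2
  linarith

theorem leftBall_subset_bend_source : leftBall ⊆ bend.source := fun _ hq =>
  lt_of_le_of_lt hq.1 (by norm_num)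

theorem mapsTo_bend : MapsTo bend leftBall fourBall := by
  rintro ⟨⟨x, y⟩, t⟩ hq
  obtain ⟨h1, h2, h3⟩ := hq
  obtain ⟨h1, h1'⟩ := abs_le.1 h1
  simp only at h1 h1' h2 h3
  change bendFun _ ∈ _
  rcases le_total 2 y with h | h
  · rw [bendFun_of_two_le h]
    have := abs_of_neg (by linarith : x < 0)
    refine ⟨?_, ?_, ?_, h3⟩ <;> simp only [this] <;> linarith
  rcases le_total y (-2) with h' | h'
  · rw [bendFun_of_le_neg_two h']
    have := abs_of_neg (by linarith : x < 0)
    refine ⟨?_, ?_, ?_, h3⟩ <;> simp only [this, abs_neg] <;> linarith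
  · have hy := abs_le.2 ⟨h', h⟩
    have e1 : |x * y / 2| = -x * |y| / 2 := by
      rw [abs_div, abs_mul, abs_of_neg (by linarith : x < 0), abs_two]
    have e2 : |2 + x - x * |y| / 2| = 2 + x - x * |y| / 2 :=
      abs_of_nonneg (by nlinarith [abs_nonneg y])
    rw [bendFun_of_abs_le hy]
    refine ⟨?_, ?_, ?_, h3⟩ <;> simp only [e1, e2] <;> nlinarith [abs_nonneg y]

/-- Where the bending is not a rigid motion, both source and image stay in `|y| ≤ 2`, away from the
planes `|y| = 3`. -/
theorem abs_bendFun_snd {x y t : ℝ} (hx : x < 0) (hx' : -2 ≤ x) :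
    |(bendFun ((x, y), t)).1.2| = |y| ∨ |(bendFun ((x, y), t)).1.2| ≤ 2 ∧ |y| ≤ 2 := by
  rcases le_total 2 y with h | h
  · left
    rw [bendFun_of_two_le h]
  rcases le_total y (-2) with h' | h'
  · left
    rw [bendFun_of_le_neg_two h', abs_neg]
  · right
    have hy := abs_le.2 ⟨h', h⟩
    rw [bendFun_of_abs_le hy]
    exact ⟨abs_le.2 ⟨by simp only; nlinarith [abs_nonneg y], by simp only; nlinarith⟩, hy⟩

theorem bendFun_mem_sheets {q : Space} (hq : q ∈ leftBall) : bendFun q ∈ sheets ↔ q ∈ sheets := by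
  have h1 := neg_of_mem_leftBall hq
  have h2 := (abs_le.1 hq.1).1
  simp only [sheets, mem_ofPred_eq]
  rcases abs_bendFun_snd (x := q.1.1) (y := q.1.2) (t := q.2) (by linarith) (by linarith)
    with h | ⟨h, h'⟩
  · rw [h]
  · constructor <;> intro h'' <;> linarith

theorem bendFun_mem_tubeUpper {q : Space} (hq : q ∈ leftBall) :
    bendFun q ∈ tubeUpper ↔ q ∈ tubeVertical (-1) := by
  have h1 := neg_of_mem_leftBall hq
  have h2 := (abs_le.1 hq.1).1
  obtain ⟨⟨x, y⟩, t⟩ := q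
  have ht : (bendFun ((x, y), t)).2 = t := rfl
  simp only at h1 h2
  simp only [tubeUpper, tubeVertical, tubed, mem_ofPred_eq, upper_bendFun (by linarith : x < 0), ht]
  rw [show (-1 - x) ^ 2 = (x - -1) ^ 2 by ring]
  rcases abs_bendFun_snd (x := x) (y := y) (t := t) (by linarith) (by linarith) with h | ⟨h, h'⟩
  · rw [h]
  · have e1 : |(bendFun ((x, y), t)).1.2| ≠ 3 := by linarith
    have e2 : |y| ≠ 3 := by linarith
    have e3 : |(bendFun ((x, y), t)).1.2| ≤ 3 := by linarith
    have e4 : |y| ≤ 3 := by linarith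
    simp only [e1, e2, e3, e4]

/-- For `y ≥ 2` nothing moves. The rest of `leftBall` misses the handle, and so does its image: the
middle part stays at heights at most 2 and the bottom part turns over to `x > 0`. There only the
planes have to be compared. -/
theorem bendFun_mem_handle {q : Space} (hq : q ∈ leftBall) : bendFun q ∈ handle ↔ q ∈ handle := by
  rcases le_or_gt 2 q.1.2 with h | h
  · rw [show bendFun q = q from bendFun_of_two_le h]
  have hx := neg_of_mem_leftBall hq
  have hq' : q ∉ handleRegion := fun hn => by
    linarith [(bounds_of_mem_handleRegion hn).2.1]
  have hb : bendFun q ∉ handleRegion := fun hn => by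
    rcases le_total q.1.2 (-2) with h' | h'
    · rw [show bendFun q = ((-q.1.1, -q.1.2), q.2) from bendFun_of_le_neg_two h'] at hn
      have := neg_of_mem_leftBall (handleRegion_subset_leftBall hn)
      simp only at this
      linarith
    · have hy := abs_le.2 ⟨h', h.le⟩
      rw [show bendFun q = ((q.1.1 * q.1.2 / 2, 2 + q.1.1 - q.1.1 * |q.1.2| / 2), q.2) from
        bendFun_of_abs_le hy] at hn
      have := (bounds_of_mem_handleRegion hn).2.1
      simp only at this
      nlinarith
  rw [mem_handle_iff_mem_sheets hq', mem_handle_iff_mem_sheets hb, bendFun_mem_sheets hq]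

theorem solidTube_upper_subset_bend_image :
    solidTube (fun x y => |x| - min (y - 1) 1) ⊆ bend '' leftBall := by
  intro p hp
  obtain ⟨h1, h2, h3⟩ := abs_le_of_mem_solidTube hp
  have hp2 : p ∈ bend.target := lt_of_le_of_lt h2 (by norm_num)
  refine ⟨bend.symm p, ?_, bend.right_inv hp2⟩
  change unbendFun p ∈ leftBall
  refine ⟨?_, ?_, ?_⟩
  · change |-1 - (|p.1.1| - min (p.1.2 - 1) 1) + 1| ≤ _
    rw [← abs_neg, show -(-1 - (|p.1.1| - min (p.1.2 - 1) 1) + 1) =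
      |p.1.1| - min (p.1.2 - 1) 1 by ring]
    linarith
  · have h4 : bendFun (unbendFun p) = p := bendFun_unbendFun hp2
    have h5 : |(unbendFun p).1.1 + 1| < 1 / 2 := bend.map_target hp2
    obtain ⟨h5, h6⟩ := abs_lt.1 h5
    rcases abs_bendFun_snd (x := (unbendFun p).1.1) (y := (unbendFun p).1.2)
      (t := (unbendFun p).2) (by linarith) (by linarith) with h | ⟨h, h'⟩
    · rw [← h]
      change |(bendFun (unbendFun p)).1.2| ≤ _
      rw [h4]
      linarith
    · linarith
  · change |p.2| ≤ 1
    linarith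

theorem handleRegion_subset_bend_image : handleRegion ⊆ bend '' leftBall := fun p hp =>
  ⟨p, handleRegion_subset_leftBall hp,
    bendFun_of_two_le (by linarith [(bounds_of_mem_handleRegion hp).2.1])⟩

/-- Precomposing the chart with `bend` turns the upper tube into the left vertical tube and the
handles on `D₁` and `D₂` into handles on the upper and lower disks of `leftBall`. -/
theorem upper_relator_mem (R : Type*) [CommRing R]
    {e : OpenPartialHomeomorph Space Space} {C N X Y : Cobordism O O'}
    (he : IsBallChart e fourBall) (hC : IsReplacement e fourBall sheets C.carrier C.carrier)
    (hN : IsReplacement e fourBall tubeUpper C.carrier N.carrier)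
    (hX : IsReplacement e fourBall handle C.carrier X.carrier)
    (hY : IsReplacement e fourBall (reflectX ⁻¹' handle) C.carrier Y.carrier) :
    (2 : R) • cls R N - (cls R X + cls R Y) ∈ neckCuttingRelators R O O' := by
  refine relator_mem_of_leftBall R (he.comp leftBall_subset_bend_source mapsTo_bend)
    (hC.comp hC mapsTo_bend (empty_subset _) (fun q _ => Iff.rfl) (fun q => bendFun_mem_sheets))
    (hN.comp hC mapsTo_bend solidTube_upper_subset_bend_image
      (fun q => mem_tubed_iff_mem_sheets) (fun q => bendFun_mem_tubeUpper))
    (hX.comp hC mapsTo_bend handleRegion_subset_bend_image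
      (fun q => mem_handle_iff_mem_sheets) (fun q => bendFun_mem_handle))
    (hY.comp hC mapsTo_bend (L := reflectX ⁻¹' handleRegion) ?_
      (fun q hq => (mem_handle_iff_mem_sheets hq).trans (reflectX_mem_sheets q)) ?_)
  · intro p hp
    obtain ⟨q, hq, hqp⟩ := handleRegion_subset_bend_image hp
    refine ⟨reflectY q, (reflectY_mem_leftBall q).2 hq, ?_⟩
    change bendFun (reflectY q) = p
    rw [bendFun_reflectY, show bendFun q = reflectX p from hqp, reflectX_reflectX]
  · intro q hq
    change reflectX (bendFun q) ∈ handle ↔ reflectY q ∈ handle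
    rw [← bendFun_reflectY]
    exact bendFun_mem_handle ((reflectY_mem_leftBall q).2 hq)

/-! ### The four tube relation from neck cutting -/

theorem fourTubeRelators_subset (R : Type*) [CommRing R] (h2 : IsUnit (2 : R)) :
    fourTubeRelators R O O' ⊆ Submodule.span R (neckCuttingRelators R O O') := by
  rintro _ ⟨e, C, C₁₂, C₃₄, C₁₃, C₂₄, he, hC, h₁₂, h₃₄, h₁₃, h₂₄, rfl⟩
  have rX := reflectX_mem_fourBall
  have rY := reflectY_mem_fourBall
  have sX := reflectX_mem_sheets
  have sY := reflectY_mem_sheets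
  have uX : ∀ q, reflectX q ∈ tubeUpper ↔ q ∈ tubeUpper := fun q => by
    simp [tubeUpper, tubed, reflectX_apply]
  -- A replacement seen in a reflected chart is rewritten in the original chart, with the picture
  -- reflected instead.
  have back : ∀ {P X : Set Space} (r : Space ≃ₜ Space), (∀ q, r (r q) = q) →
      (∀ q, r q ∈ fourBall ↔ q ∈ fourBall) → ∀ {e : OpenPartialHomeomorph Space Space},
      IsReplacement (r.transOpenPartialHomeomorph e) fourBall P C.carrier X →
      IsReplacement e fourBall (r ⁻¹' P) C.carrier X := by
    intro P X r hr hK e h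
    refine ⟨fun q hq => ?_, fun x hx => h.2 x ?_⟩
    · have := h.1 (r q) ((hK q).2 hq)
      change e (r (r q)) ∈ X ↔ _ at this
      rwa [hr] at this
    · rintro ⟨q, hq, rfl⟩
      exact hx ⟨r q, (hK q).2 hq, rfl⟩
  have heX := he.reflect reflectX rX
  have heY := he.reflect reflectY rY
  have heXY := heY.reflect reflectX rX
  have hCX := hC.reflect reflectX rX sX
  have hCY := hC.reflect reflectY rY sY
  have h₃₄' := h₃₄.reflect reflectY rY reflectY_mem_tubeLower
  have h₂₄' := h₂₄.reflect reflectX rX (reflectX_mem_tubeVertical 1)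
  -- `Xᵢ` is `C` with a handle on `Dᵢ`. The reflections move `Dᵢ` to the position of `D₁`, and the
  -- given `C₁₂` or `C₃₄` supplies the flat tube.
  obtain ⟨X₁, hX₁⟩ := exists_isReplacement_handle he hC h₁₂
  obtain ⟨X₂, hX₂⟩ := exists_isReplacement_handle heX hCX (h₁₂.reflect reflectX rX uX)
  obtain ⟨X₃, hX₃⟩ := exists_isReplacement_handle heY hCY h₃₄'
  obtain ⟨X₄, hX₄⟩ := exists_isReplacement_handle heXY (hCY.reflect reflectX rX sX)
    (h₃₄'.reflect reflectX rX uX)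
  have hX₄' := back reflectX reflectX_reflectX rX hX₄
  have k₁₂ := upper_relator_mem R he hC h₁₂ hX₁ (back reflectX reflectX_reflectX rX hX₂)
  have k₃₄ := upper_relator_mem R heY hCY h₃₄' hX₃ hX₄'
  have k₁₃ := vertical_relator_mem R he hC h₁₃ hX₁ (back reflectY reflectY_reflectY rY hX₃)
  have k₂₄ := vertical_relator_mem R heX hCX h₂₄' hX₂
    ((back reflectY reflectY_reflectY rY hX₄').reflect reflectX rX
      (P' := reflectY ⁻¹' handle) fun q => by
        change reflectX (reflectY (reflectX q)) ∈ handle ↔ reflectY q ∈ handle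
        simp [reflectX_apply, reflectY_apply])
  -- Each `Xᵢ` occurs once with each sign and cancels, leaving twice the 4Tu relator.
  have key := sub_mem (add_mem (Submodule.subset_span (R := R) k₁₂)
    (Submodule.subset_span k₃₄))
    (add_mem (Submodule.subset_span k₁₃) (Submodule.subset_span k₂₄))
  refine (Submodule.smul_mem_iff_of_isUnit _ h2).1 ?_
  convert key using 1
  module

end Bar
theorem mainTheorem12 (R : Type*) [CommRing R] (h2 : IsUnit (2 : R))
    (B : Finset (ℝ × ℝ)) (hB : (B : Set (ℝ × ℝ)) ⊆ Bar.circle) (O O' : Bar.Smoothing B) :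
    Submodule.span R (Bar.neckCuttingRelators R O O') =
      Submodule.span R (Bar.fourTubeRelators R O O') :=
  le_antisymm (Submodule.span_le.2 (Bar.neckCuttingRelators_subset R))
    (Submodule.span_le.2 (Bar.fourTubeRelators_subset R h2))
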